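/- Let $\mathcal H$ be a complex Hilbert space and $\mathfrak F(\mathcal H)=\bigoplus_{n\ge 0} S_n\mathcal H^{\otimes n}$ its bosonic (symmetrised) Fock space, where $S_n$ is the orthogonal projection of the Hilbert tensor power $\mathcal H^{\otimes n}$ onto the symmetric tensors. Let $\mathcal D\subset\mathfrak F(\mathcal H)$ be the dense subspace of vectors with finitely many particles (only finitely many non-zero components). For $\chi\in\mathcal H$ let $a^*(\chi)\Phi=\sqrt{n+1}\,S_{n+1}(\chi\otimes\Phi)$ for $\Phi\in S_n\mathcal H^{\otimes n}$, and let $a(\chi)$ be the adjoint of $a^*(\chi)$, both regarded as operators $\mathcal D\to\mathcal D$. The Weyl generator is $W[\chi]:=e^{\overline{a(\chi)-a^*(\chi)}}$. (0) For every $\chi\in\mathcal H$ the operator $W[\chi]$ is well defined and unitary: $a(\chi)-a^*(\chi)$ is closable, its closure is the infinitesimal generator of a strongly continuous one-parameter unitary group, and $W[\chi]$ is the value at time $1$ of any such group. Let $\psi\in\mathcal H$ with $\|\psi\|=1$, and let $A_\psi:=\frac{i}{2}\bigl(a(\psi)^2-a^*(\psi)^2\bigr)$ on $\mathcal D$ (the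 squeezing operator). Then: (1) Every $\Phi\in\mathcal D$ is an analytic vector for $A_\psi$: $\sum_{n\ge 0}\frac{|r|^n}{n!}\|A_\psi^n\Phi\|<\infty$ for all real $r$ with $|r|<1/2$. (2) $A_\psi$ is essentially self-adjoint on $\mathcal D$. Moreover, for every Hilbert basis $s$ of $\mathcal H$ with $\psi\in s$, the subspace $F_s:=\operatorname{span}\{S_n(b_1\otimes\cdots\otimes b_n): n\ge 0,\ b_1,\dots,b_n\in s\}$ is contained in $\mathcal D$, and $A_\psi$ restricted to $F_s$ is essentially self-adjoint. (3) There is a strongly continuous one-parameter group $\{E^{(\psi)}_\lambda\}_{\lambda\in\mathbb R}$ of unitary operators on $\mathfrak F(\mathcal H)$ whose infinitesimal generator is $i\,\overline{A_\psi}$, i.e. $E^{(\psi)}_\lambda=e^{i\lambda\overline{A_\psi}}$, such that $$E^{(\psi)}_\lambda\,W[\psi]\,E^{(\psi)*}_\lambda=W\bigl[e^{\lambda}\psi\bigr]\qquad\text{for all }\lambda\in\mathbb R.$$ -/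

import Mathlib

open scoped ComplexConjugate TensorProduct InnerProductSpace

noncomputable section

namespace BosonFock

universe u

/-! ## The inner product on algebraic tensor powers -/

section TensorPower

variable (H : Type u) [NormedAddCommGroup H] [InnerProductSpace ℂ H]

/-- The algebraic `n`-fold tensor power of `H`. This is a type synonym, so that it carries the
Hilbert space seminorm below and not the projective one. -/
def TensorPow (n : ℕ) : Type u := ⨂[ℂ] (_ : Fin n), H

instance (n : ℕ) : AddCommGroup (TensorPow H n) :=
  inferInstanceAs (AddCommGroup (⨂[ℂ] (_ : Fin n), H))

instance (n : ℕ) : Module ℂ (TensorPow H n) :=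
  inferInstanceAs (Module ℂ (⨂[ℂ] (_ : Fin n), H))

variable {H}

/-- The elementary tensor `x 0 ⊗ ⋯ ⊗ x (n - 1)`, as a multilinear map. -/
def tmk (n : ℕ) : MultilinearMap ℂ (fun _ : Fin n => H) (TensorPow H n) :=
  PiTensorProduct.tprod ℂ

/-- The universal property of the tensor power. -/
def tlift {n : ℕ} {V : Type*} [AddCommGroup V] [Module ℂ V]
    (f : MultilinearMap ℂ (fun _ : Fin n => H) V) : TensorPow H n →ₗ[ℂ] V :=
  PiTensorProduct.lift f

theorem tlift_tmk {n : ℕ} {V : Type*} [AddCommGroup V] [Module ℂ V]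
    (f : MultilinearMap ℂ (fun _ : Fin n => H) V) (x : Fin n → H) :
    tlift f (tmk n x) = f x :=
  PiTensorProduct.lift.tprod x

theorem tmk_induction {n : ℕ} {p : TensorPow H n → Prop} (t : TensorPow H n)
    (h1 : ∀ (c : ℂ) (x : Fin n → H), p (c • tmk n x))
    (h2 : ∀ s t, p s → p t → p (s + t)) : p t :=
  PiTensorProduct.induction_on (motive := p) t h1 h2

/-- The linear functional `y 0 ⊗ ⋯ ↦ ∏ i, ⟪x i, y i⟫`. -/
def bra {n : ℕ} (x : Fin n → H) : TensorPow H n →ₗ[ℂ] ℂ :=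
  tlift ((MultilinearMap.mkPiAlgebra ℂ (Fin n) ℂ).compLinearMap fun i => innerₛₗ ℂ (x i))

theorem bra_tmk {n : ℕ} (x y : Fin n → H) : bra x (tmk n y) = ∏ i, ⟪x i, y i⟫_ℂ := by
  simp [bra, tlift_tmk]

theorem conj_bra_tmk {n : ℕ} (x y : Fin n → H) :
    conj (bra x (tmk n y)) = bra y (tmk n x) := by
  simp [bra_tmk, map_prod]

/-- For fixed `t`, the multilinear map `x ↦ conj (bra x t)`. -/
def coket {n : ℕ} (t : TensorPow H n) : MultilinearMap ℂ (fun _ : Fin n => H) ℂ where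
  toFun x := conj (bra x t)
  map_update_add' {d} m i x y := by
    rw [Subsingleton.elim d (instDecidableEqFin n)]
    induction t using tmk_induction with
    | h1 c z => simp [conj_bra_tmk, mul_add]
    | h2 s t hs ht => simp only [map_add, hs, ht]; ring
  map_update_smul' {d} m i c x := by
    rw [Subsingleton.elim d (instDecidableEqFin n)]
    induction t using tmk_induction with
    | h1 d z => simp [conj_bra_tmk]; ring
    | h2 s t hs ht => simp only [map_add, hs, ht, smul_add]

/-- The inner product of tensors, determined by
`⟪x 0 ⊗ ⋯, y 0 ⊗ ⋯⟫ = ∏ i, ⟪x i, y i⟫` and sesquilinearity (see `tinner_tmk`). -/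
def tinner {n : ℕ} (s t : TensorPow H n) : ℂ := conj (tlift (coket t) s)

theorem tinner_tmk_left {n : ℕ} (x : Fin n → H) (t : TensorPow H n) :
    tinner (tmk n x) t = bra x t := by
  simp [tinner, tlift_tmk, coket]

theorem tinner_tmk {n : ℕ} (x y : Fin n → H) :
    tinner (tmk n x) (tmk n y) = ∏ i, ⟪x i, y i⟫_ℂ := by
  rw [tinner_tmk_left, bra_tmk]

theorem tinner_add_left {n : ℕ} (r s t : TensorPow H n) :
    tinner (r + s) t = tinner r t + tinner s t := by
  simp [tinner]

theorem tinner_smul_left {n : ℕ} (c : ℂ) (s t : TensorPow H n) :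
    tinner (c • s) t = conj c * tinner s t := by
  simp [tinner]

theorem tinner_add_right {n : ℕ} (r s t : TensorPow H n) :
    tinner r (s + t) = tinner r s + tinner r t := by
  induction r using tmk_induction with
  | h1 c x => simp [tinner_smul_left, tinner_tmk_left, mul_add]
  | h2 a b ha hb => simp only [tinner_add_left, ha, hb]; ring

theorem tinner_smul_right {n : ℕ} (c : ℂ) (s t : TensorPow H n) :
    tinner s (c • t) = c * tinner s t := by
  induction s using tmk_induction with
  | h1 d x => simp [tinner_smul_left, tinner_tmk_left]; ring
  | h2 a b ha hb => simp only [tinner_add_left, ha, hb]; ring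

theorem tinner_conj_symm {n : ℕ} (s t : TensorPow H n) : conj (tinner t s) = tinner s t := by
  induction s using tmk_induction with
  | h1 c x =>
    induction t using tmk_induction with
    | h1 d y =>
      simp only [tinner_smul_left, tinner_smul_right, tinner_tmk_left, map_mul, conj_bra_tmk,
        Complex.conj_conj]
      ring
    | h2 a b ha hb => simp only [tinner_add_left, tinner_add_right, map_add, ha, hb]
  | h2 a b ha hb => simp only [tinner_add_left, tinner_add_right, map_add, ha, hb]

open scoped ComplexOrder in
theorem posSemidef_gram_prod {m : ℕ} : ∀ (n : ℕ) (x : Fin m → Fin n → H),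
    (Matrix.of fun k l => ∏ i, ⟪x k i, x l i⟫_ℂ : Matrix (Fin m) (Fin m) ℂ).PosSemidef
  | 0, x => by
    have := Matrix.posSemidef_gram (𝕜 := ℂ) (fun _ : Fin m => (1 : ℂ))
    have e : (Matrix.of fun k l => ∏ i, ⟪x k i, x l i⟫_ℂ : Matrix (Fin m) (Fin m) ℂ) =
        Matrix.gram ℂ (fun _ : Fin m => (1 : ℂ)) := by
      ext k l
      simp [Matrix.gram]
    rw [e]
    exact this
  | n + 1, x => by
    have h1 := Matrix.posSemidef_gram (𝕜 := ℂ) (fun k : Fin m => x k 0)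
    have h2 := posSemidef_gram_prod n (fun k i => x k i.succ)
    have e : (Matrix.of fun k l => ∏ i, ⟪x k i, x l i⟫_ℂ : Matrix (Fin m) (Fin m) ℂ) =
        (Matrix.gram ℂ (fun k : Fin m => x k 0)).hadamard
          (Matrix.of fun k l => ∏ i : Fin n, ⟪x k i.succ, x l i.succ⟫_ℂ) := by
      ext k l
      simp [Matrix.gram, Fin.prod_univ_succ]
    rw [e]
    exact h1.hadamard h2

theorem exists_sum_tmk {n : ℕ} (t : TensorPow H n) :
    ∃ (m : ℕ) (c : Fin m → ℂ) (x : Fin m → Fin n → H), t = ∑ k, c k • tmk n (x k) := by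
  induction t using tmk_induction with
  | h1 c x => exact ⟨1, fun _ => c, fun _ => x, by simp⟩
  | h2 s t hs ht =>
    obtain ⟨m, c, x, rfl⟩ := hs
    obtain ⟨m', c', x', rfl⟩ := ht
    exact ⟨m + m', Fin.append c c', Fin.append x x', by simp [Fin.sum_univ_add]⟩

theorem tinner_sum_left {n m : ℕ} (f : Fin m → TensorPow H n) (t : TensorPow H n) :
    tinner (∑ k, f k) t = ∑ k, tinner (f k) t := by
  simp [tinner]

theorem tinner_sum_right {n m : ℕ} (f : Fin m → TensorPow H n) (t : TensorPow H n) :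
    tinner t (∑ k, f k) = ∑ k, tinner t (f k) := by
  rw [← tinner_conj_symm, tinner_sum_left, map_sum]
  simp only [tinner_conj_symm]

open scoped ComplexOrder in
theorem tinner_self_nonneg {n : ℕ} (t : TensorPow H n) : 0 ≤ (tinner t t).re := by
  obtain ⟨m, c, x, rfl⟩ := exists_sum_tmk t
  have h := (posSemidef_gram_prod n x).dotProduct_mulVec_nonneg c
  have h2 : tinner (∑ k, c k • tmk n (x k)) (∑ k, c k • tmk n (x k)) =
      star c ⬝ᵥ (Matrix.of fun k l => ∏ i, ⟪x k i, x l i⟫_ℂ).mulVec c := by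
    simp only [tinner_sum_left, tinner_sum_right, tinner_smul_left, tinner_smul_right, tinner_tmk,
      dotProduct, Matrix.mulVec, Matrix.of_apply, Pi.star_apply, Finset.mul_sum]
    rw [Finset.sum_comm]
    exact Finset.sum_congr rfl fun k _ => Finset.sum_congr rfl fun l _ => by
      rw [starRingEnd_apply]; ring
  rw [h2]
  exact (Complex.le_def.mp h).1

/-- The (pre-)Hilbert space structure of the algebraic tensor power. -/
@[reducible]
def tensorCore (n : ℕ) : PreInnerProductSpace.Core ℂ (TensorPow H n) where
  inner := tinner
  conj_inner_symm := tinner_conj_symm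
  re_inner_nonneg := tinner_self_nonneg
  add_left := tinner_add_left
  smul_left s t c := tinner_smul_left c s t

instance (n : ℕ) : SeminormedAddCommGroup (TensorPow H n) :=
  @InnerProductSpace.Core.toSeminormedAddCommGroup ℂ (TensorPow H n) _ _ _ (tensorCore n)

instance (n : ℕ) : InnerProductSpace ℂ (TensorPow H n) :=
  InnerProductSpace.ofCore (tensorCore n)

theorem inner_eq_tinner {n : ℕ} (s t : TensorPow H n) : ⟪s, t⟫_ℂ = tinner s t := rfl

/-- The linear map `x 0 ⊗ ⋯ ⊗ x (n - 1) ↦ ψ ⊗ x 0 ⊗ ⋯ ⊗ x (n - 1)`. -/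
def tcons (n : ℕ) (ψ : H) : TensorPow H n →ₗ[ℂ] TensorPow H (n + 1) :=
  tlift ((tmk (n + 1)).curryLeft ψ)

theorem tcons_tmk {n : ℕ} (ψ : H) (x : Fin n → H) :
    tcons n ψ (tmk n x) = tmk (n + 1) (Fin.cons ψ x) := by
  simp [tcons, tlift_tmk]

theorem tinner_tcons {n : ℕ} (φ ψ : H) (s t : TensorPow H n) :
    tinner (tcons n φ s) (tcons n ψ t) = ⟪φ, ψ⟫_ℂ * tinner s t := by
  induction s using tmk_induction with
  | h1 c x =>
    induction t using tmk_induction with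
    | h1 d y =>
      simp only [map_smul, tcons_tmk, tinner_smul_left, tinner_smul_right, tinner_tmk,
        Fin.prod_univ_succ, Fin.cons_zero, Fin.cons_succ]
      ring
    | h2 a b ha hb => simp only [map_add, tinner_add_right, ha, hb]; ring
  | h2 a b ha hb => simp only [map_add, tinner_add_left, ha, hb]; ring

theorem norm_tcons {n : ℕ} (ψ : H) (t : TensorPow H n) : ‖tcons n ψ t‖ = ‖ψ‖ * ‖t‖ := by
  have h := tinner_tcons ψ ψ t t
  rw [← inner_eq_tinner, ← inner_eq_tinner, inner_self_eq_norm_sq_to_K,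
    inner_self_eq_norm_sq_to_K, inner_self_eq_norm_sq_to_K] at h
  have h' : ‖tcons n ψ t‖ ^ 2 = (‖ψ‖ * ‖t‖) ^ 2 := by
    rw [mul_pow]; exact_mod_cast h
  exact (pow_left_inj₀ (norm_nonneg _) (by positivity) two_ne_zero).mp h'

end TensorPower

/-! ## Fock space -/

section Fock

variable (H : Type u) [NormedAddCommGroup H] [InnerProductSpace ℂ H]

/-- The Hilbert space tensor power of `H`. -/
abbrev HilbertTensorPow (n : ℕ) : Type u := UniformSpace.Completion (TensorPow H n)

/-- The symmetric Hilbert tensor power: the closed linear span of the symmetrised elementary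
tensors `∑ σ, x (σ 0) ⊗ ⋯ ⊗ x (σ (n - 1))`. -/
def symPow (n : ℕ) : Submodule ℂ (HilbertTensorPow H n) :=
  (Submodule.span ℂ (Set.range fun x : Fin n → H =>
    ((∑ σ : Equiv.Perm (Fin n), tmk n (x ∘ σ) : TensorPow H n) :
      HilbertTensorPow H n))).topologicalClosure

instance (n : ℕ) : CompleteSpace (symPow H n) :=
  (Submodule.isClosed_topologicalClosure _).completeSpace_coe

/-- The symmetrisation operator of the Hilbert tensor power: the orthogonal projection onto
the symmetric tensors. -/
def symmetrize (n : ℕ) : HilbertTensorPow H n →L[ℂ] symPow H n :=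
  (symPow H n).orthogonalProjectionOnto

/-- The bosonic Fock space over `H`: the Hilbert direct sum of the symmetric tensor powers. -/
abbrev Fock : Type u := lp (fun n : ℕ => symPow H n) 2

/-- The dense subspace of vectors with a finite number of particles. -/
def finiteParticle : Submodule ℂ (Fock H) where
  carrier := {Φ | {n | Φ n ≠ 0}.Finite}
  zero_mem' := by simp
  add_mem' {Φ Ψ} hΦ hΨ := by
    refine (Set.Finite.union hΦ hΨ).subset fun n hn => ?_
    by_contra h
    simp only [Set.mem_union, Set.mem_ofPred_eq, not_or, not_not] at h
    exact hn (by simp [h.1, h.2])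
  smul_mem' c Φ hΦ := by
    refine Set.Finite.subset hΦ fun n hn h => hn (by simp [h])

variable {H}

/-- The finite-particle vector with the given components. -/
def ofComponents (f : ∀ n, symPow H n) (hf : {n | f n ≠ 0}.Finite) : finiteParticle H :=
  ⟨⟨f, (memℓp_zero hf).of_exponent_ge zero_le⟩, hf⟩

/-- The operator `x ↦ ψ ⊗ x` of Hilbert tensor powers. -/
def tensorLeft (n : ℕ) (ψ : H) : HilbertTensorPow H n →L[ℂ] HilbertTensorPow H (n + 1) :=
  ((tcons n ψ).mkContinuous ‖ψ‖ fun t => (norm_tcons ψ t).le).completion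

/-- `a*(ψ)` from `n` to `n + 1` particles: `Φ ↦ √(n + 1) S (ψ ⊗ Φ)`,
where `S` is the symmetrisation. -/
def creationAt (n : ℕ) (ψ : H) : symPow H n →L[ℂ] symPow H (n + 1) :=
  ((Real.sqrt (n + 1) : ℝ) : ℂ) •
    (symmetrize H (n + 1) ∘L tensorLeft n ψ ∘L (symPow H n).subtypeL)

/-- `a(ψ)` from `n + 1` to `n` particles: the adjoint of `a*(ψ)`. -/
def annihilationAt (n : ℕ) (ψ : H) : symPow H (n + 1) →L[ℂ] symPow H n :=
  ContinuousLinearMap.adjoint (creationAt n ψ)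

/-- The components of `a*(ψ) Φ`. -/
def creationFun (ψ : H) (f : ∀ n, symPow H n) : ∀ n, symPow H n
  | 0 => 0
  | n + 1 => creationAt n ψ (f n)

/-- The creation operator `a*(ψ)` on finite-particle vectors. -/
def creation (ψ : H) : Module.End ℂ (finiteParticle H) where
  toFun Φ := ofComponents (creationFun ψ fun n => (Φ : Fock H) n) (by
    refine (Set.Finite.image Nat.succ Φ.2).subset ?_
    rintro (_ | n) hn
    · exact absurd rfl hn
    · exact ⟨n, fun h => hn (by simp [creationFun, h]), rfl⟩)
  map_add' Φ Ψ := by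
    refine Subtype.ext (lp.ext (funext fun n => ?_))
    cases n with
    | zero => exact (add_zero (0 : symPow H 0)).symm
    | succ n => exact map_add (creationAt n ψ) ((Φ : Fock H) n) ((Ψ : Fock H) n)
  map_smul' c Φ := by
    refine Subtype.ext (lp.ext (funext fun n => ?_))
    cases n <;> simp [ofComponents, creationFun]

/-- The annihilation operator `a(ψ)` on finite-particle vectors. -/
def annihilation (ψ : H) : Module.End ℂ (finiteParticle H) where
  toFun Φ := ofComponents (fun n => annihilationAt n ψ ((Φ : Fock H) (n + 1))) (by
    refine (Set.Finite.preimage (Nat.succ_injective.injOn) Φ.2).subset ?_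
    intro n hn h
    exact hn (by
      have h' : (Φ : Fock H) (n + 1) = 0 := h
      simp [h']))
  map_add' Φ Ψ := by
    refine Subtype.ext (lp.ext (funext fun n => ?_))
    exact map_add (annihilationAt n ψ) ((Φ : Fock H) (n + 1)) ((Ψ : Fock H) (n + 1))
  map_smul' c Φ := by
    refine Subtype.ext (lp.ext (funext fun n => ?_))
    simp [ofComponents]

/-- An endomorphism of the finite-particle vectors as an unbounded operator on Fock space. -/
def toUnbounded (T : Module.End ℂ (finiteParticle H)) : Fock H →ₗ.[ℂ] Fock H where
  domain := finiteParticle H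
  toFun := (finiteParticle H).subtype ∘ₗ T

/-- The squeezing operator `(i/2) (a(ψ)² - a*(ψ)²)` on finite-particle vectors. -/
def squeezing (ψ : H) : Module.End ℂ (finiteParticle H) :=
  (Complex.I / 2) • (annihilation ψ ^ 2 - creation ψ ^ 2)

/-- The linear span of the vectors `S (b 1 ⊗ ⋯ ⊗ b n)` with `n ≥ 0` and `b 1, …, b n ∈ s`.
When `s` is a Hilbert basis of `H`, these are, up to normalisation, the vectors of the
corresponding Hilbert basis of Fock space. -/
def occupationSpan (s : Set H) : Submodule ℂ (Fock H) :=
  Submodule.span ℂ {Φ | ∃ (n : ℕ) (x : Fin n → H), (∀ i, x i ∈ s) ∧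
    Φ = lp.single 2 n (symmetrize H n (tmk n x : HilbertTensorPow H n))}

end Fock

/-! ## Unbounded operators and one-parameter groups -/

section Operators

variable {K : Type u} [NormedAddCommGroup K] [InnerProductSpace ℂ K] [CompleteSpace K]

/-- `U` is a strongly continuous one-parameter group of unitary operators with infinitesimal
generator exactly `B`, i.e. `U t = exp (t B)`. -/
structure IsUnitaryGroupOf (B : K →ₗ.[ℂ] K) (U : ℝ → unitary (K →L[ℂ] K)) : Prop where
  map_zero : U 0 = 1
  map_add : ∀ s t, U (s + t) = U s * U t
  continuous : ∀ x : K, Continuous fun t => (U t : K →L[ℂ] K) x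
  generator : ∀ x y : K,
    (x, y) ∈ B.graph ↔ HasDerivAt (fun t : ℝ => (U t : K →L[ℂ] K) x) y 0

open Classical in
/-- The exponential of the generator `B` of a strongly continuous unitary group
(and, as a default value, `1` if `B` does not generate such a group). -/
def unitaryExp (B : K →ₗ.[ℂ] K) : unitary (K →L[ℂ] K) :=
  if h : ∃ U, IsUnitaryGroupOf B U then h.choose 1 else 1

/-- A densely defined operator with self-adjoint closure. -/
def IsEssentiallySelfAdjoint (A : K →ₗ.[ℂ] K) : Prop :=
  Dense (A.domain : Set K) ∧ A.IsClosable ∧ IsSelfAdjoint A.closure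

end Operators

/-- The operator `a(χ) - a*(χ)` on finite-particle vectors. -/
def weylGenerator {H : Type u} [NormedAddCommGroup H] [InnerProductSpace ℂ H] (χ : H) :
    Fock H →ₗ.[ℂ] Fock H :=
  toUnbounded (annihilation χ - creation χ)

/-- The Weyl operator `W[χ]`, the exponential of the closure of `a(χ) - a*(χ)`. -/
def weyl {H : Type u} [NormedAddCommGroup H] [InnerProductSpace ℂ H] (χ : H) :
    unitary (Fock H →L[ℂ] Fock H) :=
  unitaryExp (weylGenerator χ).closure

end BosonFock

end

noncomputable section

namespace BosonFock

open Filter Topology NormedSpace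
open scoped Nat

universe u

/-! ## Strong limits of unitary groups -/

section Nelson

variable {K : Type u} [NormedAddCommGroup K] [InnerProductSpace ℂ K] [CompleteSpace K]

/-! The proof is a version of Nelson's analytic vector theorem that builds the group directly. Let
`C` be either `a(χ) - a*(χ)` or `i A_ψ = (a*(ψ)² - a(ψ)²)/2`. Truncating the particle number gives
bounded skew-adjoint operators `T N` which agree with `C` on any given finite-particle vector once
`N` is large. If an operator adds at most `d` particles and has norm at most `c (m + 1)` on vectors
with at most `m` particles, its `k`-th power grows like `k! (c d)^k` up to a polynomial factor in
`k`. So the series of `exp (t T N)` converges on such vectors uniformly in `N` when `|t| c d < 1`.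
Squeezing has `c = 1` and `d = 2`, hence the radius `1/2`.

The unitaries `exp (t T N)` therefore converge strongly, first for small `t` on finite-particle
vectors, then on all vectors by density and for all `t` by the group law. The limit `U t` is a
unitary group given by the power series of `C` for small `t`. A vector `z` with `⟪z, C Φ⟫ = c ⟪z,
Φ⟫` for all `Φ`, `c` real and nonzero, satisfies `⟪z, U t Φ⟫ = e^{tc} ⟪z, Φ⟫`, which contradicts `‖U
t‖ ≤ 1` for small `t` of the sign of `c` unless `z = 0` (`eq_zero_of_inner_eq`). With trivial
deficiency spaces the closure of `C` is skew-adjoint and is exactly the generator of `U`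
(`mem_closure_of_inner`, `isUnitaryGroupOf`).

For the conjugation formula, the canonical commutation relation (`annihilation_mul_creation`) gives
`[C, B] = B` for `C = i A_ψ` and `B = a(ψ) - a*(ψ)`. Thus `B C^k = (C - 1)^k B`, and summing the
exponential series gives `B U s = e^{-s} U s B` on the closure of `B`. Hence the conjugated Weyl
group has generator `e^λ B`, the one belonging to `e^λ ψ`, and a group is determined by its
generator (`eq_of_dense`).

For the smaller domain, squeezing is continuous on each `n`-particle space by the closed graph
theorem, and the symmetrised tensors of basis vectors are total there, so the restricted operator
has the same closure. -/

theorem hasSum_exp_smul_apply (T : K →L[ℂ] K) (t : ℝ) (x : K) :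
    HasSum (fun k : ℕ => ((t : ℂ) ^ k / (k ! : ℂ)) • (T ^ k) x) (exp ((t : ℂ) • T) x) := by
  have h := exp_series_hasSum_exp' (𝕂 := ℂ) ((t : ℂ) • T)
  have h2 := (ContinuousLinearMap.apply ℂ K x).hasSum h
  refine h2.congr_fun fun k => ?_
  simp only [ContinuousLinearMap.apply_apply, smul_pow, smul_smul,
    div_eq_inv_mul, smul_apply]

theorem exp_smul_add (T : K →L[ℂ] K) (s t : ℝ) :
    exp (((s + t : ℝ) : ℂ) • T) = exp ((s : ℂ) • T) * exp ((t : ℂ) • T) := by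
  let +nondep : NormedAlgebra ℚ (K →L[ℂ] K) := .restrictScalars ℚ ℂ _
  rw [← exp_add_of_commute ((Commute.refl T).smul_left _ |>.smul_right _), ← add_smul]
  push_cast
  rfl

theorem exp_smul_mem_unitary {T : K →L[ℂ] K} (hT : star T = -T) (t : ℝ) :
    exp ((t : ℂ) • T) ∈ unitary (K →L[ℂ] K) := by
  let +nondep : NormedAlgebra ℚ (K →L[ℂ] K) := .restrictScalars ℚ ℂ _
  apply exp_mem_unitary_of_mem_skewAdjoint
  rw [skewAdjoint.mem_iff, star_smul, hT]
  simp

theorem norm_unitary_apply {U : K →L[ℂ] K} (hU : U ∈ unitary (K →L[ℂ] K)) (x : K) :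
    ‖U x‖ = ‖x‖ :=
  ContinuousLinearMap.norm_map_of_mem_unitary hU x

theorem norm_unitary_coe_apply (U : unitary (K →L[ℂ] K)) (x : K) :
    ‖(U : K →L[ℂ] K) x‖ = ‖x‖ :=
  norm_unitary_apply U.2 x

theorem inner_unitary_coe_apply (U : unitary (K →L[ℂ] K)) (x y : K) :
    ⟪(U : K →L[ℂ] K) x, (U : K →L[ℂ] K) y⟫_ℂ = ⟪x, y⟫_ℂ :=
  ContinuousLinearMap.inner_map_map_of_mem_unitary U.2 x y

theorem cauchySeq_apply_of_dense {u : ℕ → K →L[ℂ] K} (hu : ∀ N x, ‖u N x‖ ≤ ‖x‖) {D : Set K}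
    (hD : Dense D) (h : ∀ x ∈ D, CauchySeq fun N => u N x) (x : K) :
    CauchySeq fun N => u N x := by
  rw [Metric.cauchySeq_iff]
  intro ε hε
  obtain ⟨z, hz, hxz⟩ := Metric.dense_iff.mp hD x (ε / 3) (by positivity)
  obtain ⟨N, hN⟩ := Metric.cauchySeq_iff.mp (h z hxz) (ε / 3) (by positivity)
  refine ⟨N, fun m hm n hn => ?_⟩
  have h1 := hN m hm n hn
  have h2 : ‖x - z‖ < ε / 3 := by rw [← dist_eq_norm, dist_comm]; exact hz
  have h3 : ∀ k, dist (u k x) (u k z) < ε / 3 := fun k => by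
    rw [dist_eq_norm, ← map_sub]; exact (hu k _).trans_lt h2
  calc dist (u m x) (u n x)
      ≤ dist (u m x) (u m z) + dist (u m z) (u n z) + dist (u n z) (u n x) := dist_triangle4 _ _ _ _
    _ < ε / 3 + ε / 3 + ε / 3 := by
        have := h3 m
        have h4 := h3 n
        rw [dist_comm] at h4
        linarith
    _ = ε := by ring

theorem cauchySeq_apply_apply {u v : ℕ → K →L[ℂ] K} (hu : ∀ N x, ‖u N x‖ ≤ ‖x‖)
    (hu' : ∀ x, CauchySeq fun N => u N x) (hv : ∀ x, CauchySeq fun N => v N x) (x : K) :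
    CauchySeq fun N => u N (v N x) := by
  obtain ⟨z, hz⟩ := cauchySeq_tendsto_of_complete (hv x)
  obtain ⟨w, hw⟩ := cauchySeq_tendsto_of_complete (hu' z)
  have h : Tendsto (fun N => u N (v N x) - u N z) atTop (𝓝 0) := by
    refine squeeze_zero_norm (fun N => ?_) (tendsto_iff_norm_sub_tendsto_zero.mp hz)
    rw [← map_sub]
    exact hu N _
  have h2 := h.add hw
  simp only [sub_add_cancel, zero_add] at h2
  exact h2.cauchySeq

/-- The operator `C` on `D` is a strong limit of bounded skew-adjoint operators `T N`, such that
the power series of `exp (t T N)` on `D` converge uniformly in `N` for `|t| < δ`. -/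
structure AnalyticApprox (D : Submodule ℂ K) (C : Module.End ℂ D) (T : ℕ → K →L[ℂ] K)
    (δ : ℝ) : Prop where
  dense : Dense (D : Set K)
  pos : 0 < δ
  skew : ∀ N, star (T N) = -T N
  eventually_eq : ∀ Φ : D, ∀ᶠ N in atTop, T N Φ = C Φ
  bound : ∀ (Φ : D) (r : ℝ), 0 ≤ r → r < δ → ∃ M : ℕ → ℝ,
    (Summable fun k : ℕ => r ^ k / (k ! : ℝ) * M k) ∧ ∀ N k, ‖(T N ^ k) (Φ : K)‖ ≤ M k

namespace AnalyticApprox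

variable {D : Submodule ℂ K} {C : Module.End ℂ D} {T : ℕ → K →L[ℂ] K} {δ : ℝ}

theorem pow_eventually_eq (h : AnalyticApprox D C T δ) (k : ℕ) (Φ : D) :
    ∀ᶠ N in atTop, (T N ^ k) (Φ : K) = ((C ^ k) Φ : D) := by
  induction k generalizing Φ with
  | zero => simp
  | succ k ih =>
    filter_upwards [h.eventually_eq Φ, ih (C Φ)] with N h1 h2
    rw [pow_succ, pow_succ, mul_apply_eq_comp, h1, h2, Module.End.mul_apply]

/-- For each `k` some `T N ^ k` agrees with `C ^ k` at `Φ`; that `N` may depend on `k` because the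
bound `M` does not depend on `N`. -/
theorem bound_pow (h : AnalyticApprox D C T δ) (Φ : D) {r : ℝ} (hr : 0 ≤ r) (hr' : r < δ) :
    Summable fun k : ℕ => r ^ k / (k ! : ℝ) * ‖((C ^ k) Φ : K)‖ := by
  obtain ⟨M, hM, hb⟩ := h.bound Φ r hr hr'
  refine Summable.of_nonneg_of_le (fun k => by positivity) (fun k => ?_) hM
  obtain ⟨N, hN⟩ := (h.pow_eventually_eq k Φ).exists
  gcongr
  rw [← hN]
  exact hb N k

theorem summable_norm (h : AnalyticApprox D C T δ) (Φ : D) {t : ℝ} (ht : |t| < δ) :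
    Summable fun k : ℕ => ‖((t : ℂ) ^ k / (k ! : ℂ)) • ((C ^ k) Φ : K)‖ := by
  simpa [norm_smul] using h.bound_pow Φ (abs_nonneg t) ht

theorem inner_skew (h : AnalyticApprox D C T δ) (Φ Ψ : D) :
    ⟪(C Φ : K), (Ψ : K)⟫_ℂ = -⟪(Φ : K), (C Ψ : K)⟫_ℂ := by
  obtain ⟨N, h1, h2⟩ := ((h.eventually_eq Φ).and (h.eventually_eq Ψ)).exists
  rw [← h1, ← h2, ← ContinuousLinearMap.adjoint_inner_right, ← ContinuousLinearMap.star_eq_adjoint,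
    h.skew]
  simp

/-- Dominated convergence for series: each term is eventually constant in `N`, and `M` dominates
uniformly in `N`. -/
theorem tendsto_exp_tsum (h : AnalyticApprox D C T δ) (Φ : D) {t : ℝ} (ht : |t| < δ) :
    Tendsto (fun N => exp ((t : ℂ) • T N) (Φ : K)) atTop
      (𝓝 (∑' k : ℕ, ((t : ℂ) ^ k / (k ! : ℂ)) • ((C ^ k) Φ : K))) := by
  obtain ⟨M, hM, hb⟩ := h.bound Φ |t| (abs_nonneg t) ht
  have := tendsto_tsum_of_dominated_convergence
    (f := fun N (k : ℕ) => ((t : ℂ) ^ k / (k ! : ℂ)) • (T N ^ k) (Φ : K))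
    (g := fun k : ℕ => ((t : ℂ) ^ k / (k ! : ℂ)) • ((C ^ k) Φ : K)) (𝓕 := atTop) hM
    (fun k => tendsto_const_nhds.congr' ((h.pow_eventually_eq k Φ).mono fun N hN => by simp only [hN]))
    (Eventually.of_forall fun N k => by
      rw [norm_smul]
      simp only [norm_div, norm_pow, Complex.norm_real, Complex.norm_natCast, Real.norm_eq_abs]
      gcongr
      exact hb N k)
  refine this.congr fun N => (hasSum_exp_smul_apply (T N) t Φ).tsum_eq

theorem norm_exp_apply (h : AnalyticApprox D C T δ) (t : ℝ) (N : ℕ) (x : K) :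
    ‖exp ((t : ℂ) • T N) x‖ = ‖x‖ :=
  norm_unitary_apply (exp_smul_mem_unitary (h.skew N) t) x

theorem cauchySeq_exp (h : AnalyticApprox D C T δ) (t : ℝ) (x : K) :
    CauchySeq fun N => exp ((t : ℂ) • T N) x := by
  have hsmall : ∀ t : ℝ, |t| < δ → ∀ x : K, CauchySeq fun N => exp ((t : ℂ) • T N) x :=
    fun t ht => cauchySeq_apply_of_dense (fun N x => (h.norm_exp_apply t N x).le) h.dense
      fun Φ hΦ => (h.tendsto_exp_tsum ⟨Φ, hΦ⟩ ht).cauchySeq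
  have hmul : ∀ (t : ℝ), |t| < δ → ∀ n : ℕ, ∀ x : K,
      CauchySeq fun N => exp (((n * t : ℝ) : ℂ) • T N) x := by
    intro t ht n
    induction n with
    | zero =>
      intro x
      simpa using cauchySeq_const x
    | succ n ih =>
      intro x
      have e : ((n + 1 : ℕ) : ℝ) * t = t + n * t := by push_cast; ring
      simp only [e, exp_smul_add]
      exact cauchySeq_apply_apply (fun N x => (h.norm_exp_apply t N x).le) (hsmall t ht) ih x
  -- A large time is cut into `n` steps of length `|t| / n < δ`, for which the series argument
  -- applies.
  obtain ⟨n, hn⟩ := exists_nat_gt (|t| / δ)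
  have hn0 : (0 : ℝ) < n := (div_nonneg (abs_nonneg t) h.pos.le).trans_lt hn
  have := hmul (t / n) (by
    rw [abs_div, Nat.abs_cast, div_lt_iff₀ hn0]
    rw [div_lt_iff₀ h.pos] at hn
    linarith) n x
  rwa [mul_div_cancel₀ t hn0.ne'] at this

/-- The strong limit of the groups `exp (t T N)`. -/
def limitFun (h : AnalyticApprox D C T δ) (t : ℝ) (x : K) : K :=
  (cauchySeq_tendsto_of_complete (h.cauchySeq_exp t x)).choose

theorem tendsto_limitFun (h : AnalyticApprox D C T δ) (t : ℝ) (x : K) :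
    Tendsto (fun N => exp ((t : ℂ) • T N) x) atTop (𝓝 (h.limitFun t x)) :=
  (cauchySeq_tendsto_of_complete (h.cauchySeq_exp t x)).choose_spec

theorem norm_limitFun (h : AnalyticApprox D C T δ) (t : ℝ) (x : K) : ‖h.limitFun t x‖ = ‖x‖ :=
  tendsto_nhds_unique (h.tendsto_limitFun t x).norm (by
    simp only [h.norm_exp_apply]
    exact tendsto_const_nhds)

/-- The strong limit of the groups `exp (t T N)`, as a bounded operator. -/
def limitCLM (h : AnalyticApprox D C T δ) (t : ℝ) : K →L[ℂ] K :=
  LinearMap.mkContinuous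
    { toFun := h.limitFun t
      map_add' := fun x y => tendsto_nhds_unique (h.tendsto_limitFun t (x + y)) (by
        simpa using (h.tendsto_limitFun t x).add (h.tendsto_limitFun t y))
      map_smul' := fun c x => tendsto_nhds_unique (h.tendsto_limitFun t (c • x)) (by
        simpa using (h.tendsto_limitFun t x).const_smul c) } 1
    fun x => by simp [h.norm_limitFun]

theorem tendsto_limitCLM (h : AnalyticApprox D C T δ) (t : ℝ) (x : K) :
    Tendsto (fun N => exp ((t : ℂ) • T N) x) atTop (𝓝 (h.limitCLM t x)) :=
  h.tendsto_limitFun t x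

theorem norm_limitCLM (h : AnalyticApprox D C T δ) (t : ℝ) (x : K) : ‖h.limitCLM t x‖ = ‖x‖ :=
  h.norm_limitFun t x

theorem limitCLM_add (h : AnalyticApprox D C T δ) (s t : ℝ) :
    h.limitCLM (s + t) = h.limitCLM s * h.limitCLM t := by
  ext x
  refine tendsto_nhds_unique (h.tendsto_limitCLM (s + t) x) ?_
  have h1 : Tendsto (fun N => exp ((s : ℂ) • T N) (exp ((t : ℂ) • T N) x)
      - exp ((s : ℂ) • T N) (h.limitCLM t x)) atTop (𝓝 0) := by
    refine squeeze_zero_norm (fun N => ?_)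
      (tendsto_iff_norm_sub_tendsto_zero.mp (h.tendsto_limitCLM t x))
    rw [← map_sub, h.norm_exp_apply]
  have h2 := h1.add (h.tendsto_limitCLM s (h.limitCLM t x))
  simp only [sub_add_cancel, zero_add] at h2
  simpa only [exp_smul_add, mul_apply_eq_comp] using h2

theorem limitCLM_zero (h : AnalyticApprox D C T δ) : h.limitCLM 0 = 1 := by
  ext x
  refine tendsto_nhds_unique (h.tendsto_limitCLM 0 x) ?_
  simp

theorem limitCLM_mem_unitary (h : AnalyticApprox D C T δ) (t : ℝ) :
    h.limitCLM t ∈ unitary (K →L[ℂ] K) := by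
  have h1 : star (h.limitCLM t) * h.limitCLM t = 1 := by
    rw [ContinuousLinearMap.star_eq_adjoint]
    exact (ContinuousLinearMap.norm_map_iff_adjoint_comp_self _).mp (h.norm_limitCLM t)
  -- A strong limit of unitaries is in general only isometric; the group law supplies the right
  -- inverse.
  have h2 : h.limitCLM t * h.limitCLM (-t) = 1 := by
    rw [← h.limitCLM_add, add_neg_cancel, h.limitCLM_zero]
  rw [Unitary.mem_iff]
  refine ⟨h1, ?_⟩
  rwa [left_inv_eq_right_inv h1 h2]

/-- The unitary group generated by the closure of `C`. -/
def group (h : AnalyticApprox D C T δ) (t : ℝ) : unitary (K →L[ℂ] K) :=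
  ⟨h.limitCLM t, h.limitCLM_mem_unitary t⟩

theorem group_zero (h : AnalyticApprox D C T δ) : h.group 0 = 1 :=
  Subtype.ext h.limitCLM_zero

theorem group_add (h : AnalyticApprox D C T δ) (s t : ℝ) :
    h.group (s + t) = h.group s * h.group t :=
  Subtype.ext (h.limitCLM_add s t)

theorem group_hasSum (h : AnalyticApprox D C T δ) (Φ : D) {t : ℝ} (ht : |t| < δ) :
    HasSum (fun k : ℕ => ((t : ℂ) ^ k / (k ! : ℂ)) • ((C ^ k) Φ : K))
      ((h.group t : K →L[ℂ] K) Φ) := by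
  have h1 := (h.summable_norm Φ ht).of_norm.hasSum
  rwa [tendsto_nhds_unique (h.tendsto_exp_tsum Φ ht) (h.tendsto_limitCLM t Φ)] at h1

theorem group_hasDerivAt_zero (h : AnalyticApprox D C T δ) (Φ : D) :
    HasDerivAt (fun t : ℝ => (h.group t : K →L[ℂ] K) Φ) (C Φ : K) 0 := by
  have hr : 0 < δ / 2 := half_pos h.pos
  have hs := h.bound_pow Φ hr.le (half_lt_self h.pos)
  set S := ∑' k : ℕ, (δ / 2) ^ k / (k ! : ℝ) * ‖((C ^ k) Φ : K)‖ with hS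
  have key : ∀ t : ℝ, |t| ≤ δ / 2 →
      ‖(h.group t : K →L[ℂ] K) Φ - Φ - (t : ℂ) • (C Φ : K)‖ ≤ (S / (δ / 2) ^ 2) * ‖t ^ 2‖ := by
    intro t ht
    have h1 := (hasSum_nat_add_iff' 2).mpr (h.group_hasSum Φ (ht.trans_lt (half_lt_self h.pos)))
    simp only [Finset.sum_range_succ, Finset.sum_range_zero, pow_zero, Nat.factorial_zero,
      Nat.cast_one, div_one, one_smul, zero_add, pow_one, Nat.factorial_one,
      Module.End.one_apply] at h1
    rw [sub_sub, ← h1.tsum_eq]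
    -- The remainder after the linear term is compared with the series at radius `δ / 2`: `|t|^(k+2)
    -- ≤ t² (δ/2)^k` turns it into `O(t²)`.
    have h2 := hs.mul_left (t ^ 2 / (δ / 2) ^ 2)
    have h3 := h2.comp_injective (add_left_injective 2)
    refine (tsum_of_norm_bounded h3.hasSum fun k => ?_).trans ?_
    · rw [norm_smul]
      simp only [norm_div, norm_pow, Complex.norm_real, Complex.norm_natCast, Real.norm_eq_abs,
        Function.comp_apply]
      rw [← mul_assoc]
      gcongr
      rw [← sq_abs t, pow_add, pow_add]
      calc |t| ^ k * |t| ^ 2 / ((k + 2)! : ℝ) ≤ (δ / 2) ^ k * |t| ^ 2 / ((k + 2)! : ℝ) := by gcongr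
        _ = _ := by
          have := h.pos.ne'
          field_simp
    · refine (tsum_comp_le_tsum_of_inj h2 (fun k => by positivity) (add_left_injective 2)).trans ?_
      rw [tsum_mul_left, ← hS, Real.norm_eq_abs, abs_of_nonneg (sq_nonneg t)]
      exact le_of_eq (by ring)
  rw [hasDerivAt_iff_isLittleO_nhds_zero]
  have hO : (fun t : ℝ => (h.group (0 + t) : K →L[ℂ] K) Φ - (h.group 0 : K →L[ℂ] K) Φ -
      t • (C Φ : K)) =O[𝓝 0] fun t : ℝ => t ^ 2 := by
    refine Asymptotics.IsBigO.of_bound (S / (δ / 2) ^ 2) ?_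
    filter_upwards [Metric.closedBall_mem_nhds (0 : ℝ) hr] with t ht
    rw [zero_add, h.group_zero]
    exact key t (by simpa using ht)
  refine hO.trans_isLittleO ?_
  exact Asymptotics.isLittleO_pow_id one_lt_two

theorem group_hasDerivAt (h : AnalyticApprox D C T δ) (Φ : D) (t : ℝ) :
    HasDerivAt (fun t : ℝ => (h.group t : K →L[ℂ] K) Φ) ((h.group t : K →L[ℂ] K) (C Φ)) t := by
  have h1 := (h.group_hasDerivAt_zero Φ)
  rw [← sub_self t] at h1
  have h2 := h1.comp_sub_const t t
  have h3 := ((h.group t : K →L[ℂ] K).restrictScalars ℝ).hasFDerivAt.comp_hasDerivAt t h2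
  refine h3.congr_of_eventuallyEq (Eventually.of_forall fun s => ?_)
  change _ = (h.group t : K →L[ℂ] K) ((h.group (s - t) : K →L[ℂ] K) Φ)
  rw [← mul_apply_eq_comp, ← Submonoid.coe_mul, ← h.group_add, add_sub_cancel]

theorem group_continuous (h : AnalyticApprox D C T δ) (x : K) :
    Continuous fun t : ℝ => (h.group t : K →L[ℂ] K) x := by
  rw [Metric.continuous_iff]
  intro t ε hε
  obtain ⟨z, hz, hxz⟩ := Metric.dense_iff.mp h.dense x (ε / 3) (by positivity)
  have hc : Continuous fun t : ℝ => (h.group t : K →L[ℂ] K) z :=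
    continuous_iff_continuousAt.mpr fun t => (h.group_hasDerivAt ⟨z, hxz⟩ t).continuousAt
  obtain ⟨d, hd, hd'⟩ := Metric.continuous_iff.mp hc t (ε / 3) (by positivity)
  refine ⟨d, hd, fun s hs => ?_⟩
  have h3 : ∀ k, dist ((h.group k : K →L[ℂ] K) x) ((h.group k : K →L[ℂ] K) z) < ε / 3 := fun k => by
    rw [dist_eq_norm, ← map_sub, norm_unitary_coe_apply, ← dist_eq_norm, dist_comm]; exact hz
  calc _ ≤ _ := dist_triangle4 _ ((h.group s : K →L[ℂ] K) z) ((h.group t : K →L[ℂ] K) z) _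
    _ < ε / 3 + ε / 3 + ε / 3 := by
        have := h3 s
        have h4 := h3 t
        rw [dist_comm] at h4
        linarith [hd' s hs]
    _ = ε := by ring

end AnalyticApprox

end Nelson

/-! ## Generators of unitary groups -/

section Generators

variable {K : Type u} [NormedAddCommGroup K] [InnerProductSpace ℂ K] [CompleteSpace K]

namespace IsUnitaryGroupOf

variable {B : K →ₗ.[ℂ] K} {U V : ℝ → unitary (K →L[ℂ] K)}

theorem apply_add (h : IsUnitaryGroupOf B U) (s t : ℝ) (x : K) :
    (U (s + t) : K →L[ℂ] K) x = (U s : K →L[ℂ] K) ((U t : K →L[ℂ] K) x) := by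
  rw [h.map_add]
  rfl

theorem apply_mem_graph (h : IsUnitaryGroupOf B U) {x y : K} (hxy : (x, y) ∈ B.graph) (t : ℝ) :
    ((U t : K →L[ℂ] K) x, (U t : K →L[ℂ] K) y) ∈ B.graph := by
  rw [h.generator] at hxy ⊢
  have h3 := ((U t : K →L[ℂ] K).restrictScalars ℝ).hasFDerivAt.comp_hasDerivAt 0 hxy
  refine h3.congr_of_eventuallyEq (Eventually.of_forall fun s => ?_)
  change (U s : K →L[ℂ] K) ((U t : K →L[ℂ] K) x) = (U t : K →L[ℂ] K) ((U s : K →L[ℂ] K) x)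
  rw [← h.apply_add, ← h.apply_add, add_comm]

theorem hasDerivAt (h : IsUnitaryGroupOf B U) {x y : K} (hxy : (x, y) ∈ B.graph) (t : ℝ) :
    HasDerivAt (fun t : ℝ => (U t : K →L[ℂ] K) x) ((U t : K →L[ℂ] K) y) t := by
  have h1 := (h.generator _ _).mp (h.apply_mem_graph hxy t)
  rw [← sub_self t] at h1
  refine (h1.comp_sub_const t t).congr_of_eventuallyEq (Eventually.of_forall fun s => ?_)
  change _ = (U (s - t) : K →L[ℂ] K) ((U t : K →L[ℂ] K) x)
  rw [← h.apply_add, sub_add_cancel]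

/-- Differentiate the constant function `t ↦ ⟪U t x, U t x'⟫` at `0`. -/
theorem inner_add_inner_eq_zero (h : IsUnitaryGroupOf B U) {x y x' y' : K}
    (hxy : (x, y) ∈ B.graph) (hxy' : (x', y') ∈ B.graph) : ⟪x, y'⟫_ℂ + ⟪y, x'⟫_ℂ = 0 := by
  have h1 := ((h.generator _ _).mp hxy).inner ℂ ((h.generator _ _).mp hxy')
  simp only [inner_unitary_coe_apply, h.map_zero] at h1
  exact h1.unique (hasDerivAt_const 0 _)

/-- By skew-symmetry of the generator, `⟪U s x, V s y⟫` has zero derivative for `x`, `y` in its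
domain. Its constancy makes `‖U t x - V t x‖² = 0`, and density extends this to all vectors. -/
theorem eq_of_dense (h : IsUnitaryGroupOf B U) (h' : IsUnitaryGroupOf B V)
    (hB : Dense (B.domain : Set K)) : U = V := by
  have key : ∀ (t : ℝ) (x y : B.domain),
      ⟪(U t : K →L[ℂ] K) x, (V t : K →L[ℂ] K) y⟫_ℂ = ⟪(x : K), (y : K)⟫_ℂ := by
    intro t x y
    have hd : ∀ s : ℝ, HasDerivAt
        (fun s => ⟪(U s : K →L[ℂ] K) x, (V s : K →L[ℂ] K) y⟫_ℂ) 0 s := fun s => by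
      have h1 := (h.hasDerivAt (B.mem_graph x) s).inner ℂ (h'.hasDerivAt (B.mem_graph y) s)
      rwa [h.inner_add_inner_eq_zero (h.apply_mem_graph (B.mem_graph x) s)
        (h'.apply_mem_graph (B.mem_graph y) s)] at h1
    have := is_const_of_deriv_eq_zero (fun s => (hd s).differentiableAt) (fun s => (hd s).deriv) t 0
    simpa [h.map_zero, h'.map_zero] using this
  ext t x
  have h2 : ∀ x ∈ B.domain, (U t : K →L[ℂ] K) x = (V t : K →L[ℂ] K) x := fun x hx => by
    have h3 : ⟪(U t : K →L[ℂ] K) x, (V t : K →L[ℂ] K) x⟫_ℂ = ⟪x, x⟫_ℂ := key t ⟨x, hx⟩ ⟨x, hx⟩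
    rw [← sub_eq_zero, ← inner_self_eq_zero (𝕜 := ℂ), inner_sub_sub_self, inner_unitary_coe_apply,
      inner_unitary_coe_apply, h3, ← inner_conj_symm ((V t : K →L[ℂ] K) x), h3, inner_conj_symm]
    ring
  exact congrFun (Continuous.ext_on hB (U t : K →L[ℂ] K).continuous (V t : K →L[ℂ] K).continuous
    h2) x

/-- Uniqueness makes the arbitrary choice in `unitaryExp` harmless. -/
theorem unitaryExp_eq (h : IsUnitaryGroupOf B U) (hB : Dense (B.domain : Set K)) :
    unitaryExp B = U 1 := by
  have hex : ∃ U, IsUnitaryGroupOf B U := ⟨U, h⟩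
  rw [unitaryExp, dif_pos hex, hex.choose_spec.eq_of_dense h hB]

end IsUnitaryGroupOf

/-- An endomorphism of a subspace as an unbounded operator. -/
def operatorOn (D : Submodule ℂ K) (C : Module.End ℂ D) : K →ₗ.[ℂ] K where
  domain := D
  toFun := D.subtype ∘ₗ C

/-! ### Graph closures, closability and nonzero scalar multiples -/

section OperatorOn

variable {D : Submodule ℂ K} {C : Module.End ℂ D}

theorem mk_mem_graph_operatorOn (C : Module.End ℂ D) (Φ : D) :
    ((Φ : K), (C Φ : K)) ∈ (operatorOn D C).graph :=
  (operatorOn D C).mem_graph Φ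

theorem mem_graph_operatorOn {p : K × K} :
    p ∈ (operatorOn D C).graph ↔ ∃ Φ : D, ((Φ : K), (C Φ : K)) = p := by
  constructor
  · intro h
    obtain ⟨Φ, h1, h2⟩ := (LinearPMap.mem_graph_iff _).mp h
    exact ⟨Φ, Prod.ext h1 h2⟩
  · rintro ⟨Φ, rfl⟩
    exact mk_mem_graph_operatorOn C Φ

theorem closure_graph_induction {f : K →ₗ.[ℂ] K} {p : K × K → Prop}
    (hp : IsClosed {q | p q}) (h : ∀ q ∈ f.graph, p q) {q : K × K}
    (hq : q ∈ f.graph.topologicalClosure) : p q :=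
  closure_minimal (t := {q | p q}) h hp hq

theorem smul_mem_closure_graph_smul (f : K →ₗ.[ℂ] K) (c : ℂ) {x y : K}
    (h : (x, y) ∈ f.graph.topologicalClosure) :
    (x, c • y) ∈ (c • f).graph.topologicalClosure := by
  refine map_mem_closure (f := fun q : K × K => (q.1, c • q.2)) (by fun_prop) h fun q hq => ?_
  obtain ⟨Φ, h1, h2⟩ := (LinearPMap.mem_graph_iff _).mp hq
  exact (LinearPMap.mem_graph_iff _).mpr ⟨Φ, h1, by simp [h2]⟩

theorem mem_closure_graph_smul_iff (f : K →ₗ.[ℂ] K) {c : ℂ} (hc : c ≠ 0) {x y : K} :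
    (x, c • y) ∈ (c • f).graph.topologicalClosure ↔ (x, y) ∈ f.graph.topologicalClosure := by
  refine ⟨fun h => ?_, smul_mem_closure_graph_smul f c⟩
  have := smul_mem_closure_graph_smul (c • f) c⁻¹ h
  rwa [smul_smul, smul_smul, inv_mul_cancel₀ hc, one_smul, one_smul] at this

theorem operatorOn_smul (c : ℂ) (C : Module.End ℂ D) :
    operatorOn D (c • C) = c • operatorOn D C := rfl

theorem isClosable_iff {f : K →ₗ.[ℂ] K} :
    f.IsClosable ↔ ∀ y, (0, y) ∈ f.graph.topologicalClosure → y = 0 := by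
  constructor
  · rintro ⟨g, hg⟩ y hy
    rw [hg] at hy
    exact g.graph_fst_eq_zero_snd hy rfl
  · intro h
    refine ⟨f.graph.topologicalClosure.toLinearPMap,
      (Submodule.toLinearPMap_graph_eq _ fun x hx hx0 => ?_).symm⟩
    obtain ⟨a, b⟩ := x
    obtain rfl : a = 0 := hx0
    exact h b hx

theorem isClosable_smul {f : K →ₗ.[ℂ] K} (hf : f.IsClosable) {c : ℂ} (hc : c ≠ 0) :
    (c • f).IsClosable := by
  rw [isClosable_iff] at hf ⊢
  intro y hy
  rw [← one_smul ℂ y, ← mul_inv_cancel₀ hc, mul_smul, mem_closure_graph_smul_iff _ hc] at hy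
  have := hf _ hy
  rwa [smul_eq_zero_iff_right (inv_ne_zero hc)] at this

theorem closure_smul {f : K →ₗ.[ℂ] K} (hf : f.IsClosable) {c : ℂ} (hc : c ≠ 0) :
    (c • f).closure = c • f.closure := by
  refine LinearPMap.eq_of_eq_graph ?_
  rw [← (isClosable_smul hf hc).graph_closure_eq_closure_graph]
  ext ⟨x, y⟩
  obtain ⟨z, rfl⟩ : ∃ z, y = c • z := ⟨c⁻¹ • y, by rw [smul_smul, mul_inv_cancel₀ hc, one_smul]⟩
  rw [mem_closure_graph_smul_iff _ hc, hf.graph_closure_eq_closure_graph,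
    LinearPMap.mem_graph_iff, LinearPMap.mem_graph_iff]
  refine exists_congr fun Φ => and_congr_right fun _ => ?_
  exact (smul_right_inj hc).symm

end OperatorOn

/-! ### The closure as exact generator: trivial deficiency spaces and skew-adjointness -/

namespace AnalyticApprox

variable {D : Submodule ℂ K} {C : Module.End ℂ D} {T : ℕ → K →L[ℂ] K} {δ : ℝ}

/-- Along a sequence in the graph tending to `(x, y)` the derivatives converge uniformly in `t`,
since the group is isometric; so differentiation passes to the limit. -/
theorem group_hasDerivAt_of_mem_closure (h : AnalyticApprox D C T δ) {x y : K}
    (hxy : (x, y) ∈ (operatorOn D C).graph.topologicalClosure) :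
    HasDerivAt (fun t : ℝ => (h.group t : K →L[ℂ] K) x) y 0 := by
  obtain ⟨u, hu, hlim⟩ := mem_closure_iff_seq_limit.mp hxy
  choose Φ hΦ using fun n => mem_graph_operatorOn.mp (hu n)
  obtain rfl : (fun n => ((Φ n : K), (C (Φ n) : K))) = u := funext hΦ
  have h1 : Tendsto (fun n => (Φ n : K)) atTop (𝓝 x) := (Prod.tendsto_iff _ _).mp hlim |>.1
  have h2 : Tendsto (fun n => (C (Φ n) : K)) atTop (𝓝 y) := (Prod.tendsto_iff _ _).mp hlim |>.2
  have h3 := hasDerivAt_of_tendstoUniformly (𝕜 := ℝ) (l := atTop)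
    (f := fun n t => (h.group t : K →L[ℂ] K) (Φ n))
    (f' := fun n t => (h.group t : K →L[ℂ] K) (C (Φ n)))
    (g := fun t => (h.group t : K →L[ℂ] K) x) (g' := fun t => (h.group t : K →L[ℂ] K) y)
    (by
      rw [Metric.tendstoUniformly_iff]
      intro ε hε
      filter_upwards [Metric.tendsto_nhds.mp h2 ε hε] with n hn t
      rw [dist_eq_norm, ← map_sub, norm_unitary_coe_apply, ← dist_eq_norm, dist_comm]
      exact hn)
    (Eventually.of_forall fun n t => h.group_hasDerivAt (Φ n) t)
    (fun t => ((h.group t : K →L[ℂ] K).continuous.tendsto x).comp h1) 0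
  simpa [h.group_zero] using h3

theorem inner_of_mem_closure (h : AnalyticApprox D C T δ) {x y : K}
    (hxy : (x, y) ∈ (operatorOn D C).graph.topologicalClosure) (Φ : D) :
    ⟪(C Φ : K), x⟫_ℂ = -⟪(Φ : K), y⟫_ℂ := by
  refine closure_graph_induction (p := fun q => ⟪(C Φ : K), q.1⟫_ℂ = -⟪(Φ : K), q.2⟫_ℂ)
    (isClosed_eq (by fun_prop) (by fun_prop)) (fun q hq => ?_) hxy
  obtain ⟨Ψ, rfl⟩ := mem_graph_operatorOn.mp hq
  exact h.inner_skew Φ Ψ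

theorem inner_skew_of_mem_closure (h : AnalyticApprox D C T δ) {x y x' y' : K}
    (hxy : (x, y) ∈ (operatorOn D C).graph.topologicalClosure)
    (hxy' : (x', y') ∈ (operatorOn D C).graph.topologicalClosure) :
    ⟪y', x⟫_ℂ = -⟪x', y⟫_ℂ := by
  refine closure_graph_induction (p := fun q => ⟪q.2, x⟫_ℂ = -⟪q.1, y⟫_ℂ)
    (isClosed_eq (by fun_prop) (by fun_prop)) (fun q hq => ?_) hxy'
  obtain ⟨Ψ, rfl⟩ := mem_graph_operatorOn.mp hq
  exact h.inner_of_mem_closure hxy Ψ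

/-- The deficiency spaces of `C` are trivial. -/
theorem eq_zero_of_inner_eq (h : AnalyticApprox D C T δ) {c : ℝ} (hc : c ≠ 0) {z : K}
    (hz : ∀ Φ : D, ⟪z, (C Φ : K)⟫_ℂ = c * ⟪z, (Φ : K)⟫_ℂ) : z = 0 := by
  have hpow : ∀ (k : ℕ) (Φ : D), ⟪z, ((C ^ k) Φ : K)⟫_ℂ = (c : ℂ) ^ k * ⟪z, (Φ : K)⟫_ℂ := by
    intro k
    induction k with
    | zero => simp
    | succ k ih =>
      intro Φ
      rw [pow_succ, Module.End.mul_apply, ih, hz]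
      ring
  -- The sign of `t` is that of `c`, so that `e^{tc} > 1`, while `|t| < δ` keeps the power series
  -- available.
  obtain ⟨t, ht, hct⟩ : ∃ t : ℝ, |t| < δ ∧ 0 < t * c := by
    rcases lt_or_gt_of_ne hc with hc | hc
    · refine ⟨-(δ / 2), ?_, by nlinarith [h.pos]⟩
      rw [abs_neg, abs_of_pos (half_pos h.pos)]
      exact half_lt_self h.pos
    · refine ⟨δ / 2, ?_, by nlinarith [h.pos]⟩
      rw [abs_of_pos (half_pos h.pos)]
      exact half_lt_self h.pos
  have hexp : ∀ Φ : D, ⟪z, (h.group t : K →L[ℂ] K) Φ⟫_ℂ =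
      (Real.exp (t * c) : ℂ) * ⟪z, (Φ : K)⟫_ℂ := by
    intro Φ
    have h1 := (innerSL ℂ z).hasSum (h.group_hasSum Φ ht)
    have h2 := (expSeries_div_hasSum_exp ((t * c : ℝ) : ℂ)).mul_right ⟪z, (Φ : K)⟫_ℂ
    rw [← Complex.exp_eq_exp_ℂ, ← Complex.ofReal_exp] at h2
    refine h1.unique (h2.congr_fun fun k => ?_)
    simp only [innerSL_apply_apply, inner_smul_right, hpow]
    push_cast
    ring
  have hle : ∀ x : K, Real.exp (t * c) * ‖⟪z, x⟫_ℂ‖ ≤ ‖z‖ * ‖x‖ := by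
    intro x
    refine h.dense.induction (P := fun x => Real.exp (t * c) * ‖⟪z, x⟫_ℂ‖ ≤ ‖z‖ * ‖x‖)
      (fun x hx => ?_) (isClosed_le (by fun_prop) (by fun_prop)) x
    have h1 := norm_inner_le_norm (𝕜 := ℂ) z ((h.group t : K →L[ℂ] K) x)
    rw [hexp ⟨x, hx⟩, norm_unitary_coe_apply, norm_mul, Complex.norm_real, Real.norm_eq_abs,
      Real.abs_exp] at h1
    exact h1
  -- At `x = z` the bound reads `e^{tc} ‖z‖² ≤ ‖z‖²`.
  have h1 := hle z
  rw [← inner_self_re_eq_norm, inner_self_eq_norm_mul_norm] at h1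
  by_contra hne
  have hz : 0 < ‖z‖ * ‖z‖ := by positivity
  nlinarith [Real.add_one_lt_exp hct.ne']

/-- Surjectivity of `1 - C̄`, where `C̄` is the closure. Skew-symmetry gives `‖x - y‖² = ‖x‖² +
‖y‖²` on the closed graph, so `(x, y) ↦ x - y` is bounded below and has closed range; a vector
orthogonal to the range lies in the deficiency space with `c = 1`. -/
theorem exists_sub_eq (h : AnalyticApprox D C T δ) (z : K) :
    ∃ x y, (x, y) ∈ (operatorOn D C).graph.topologicalClosure ∧ x - y = z := by
  set G := (operatorOn D C).graph.topologicalClosure with hG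
  let f : G →L[ℂ] K := (ContinuousLinearMap.fst ℂ K K - ContinuousLinearMap.snd ℂ K K) ∘L G.subtypeL
  have hf : ∀ q : G, f q = q.1.1 - q.1.2 := fun q => rfl
  have hGc : IsClosed (G : Set (K × K)) := Submodule.isClosed_topologicalClosure _
  have : CompleteSpace G := hGc.completeSpace_coe
  have hanti : AntilipschitzWith 1 f := by
    refine f.antilipschitz_of_bound fun q => ?_
    have h1 : RCLike.re ⟪q.1.1, q.1.2⟫_ℂ = 0 := by
      have h2 := h.inner_skew_of_mem_closure q.2 q.2
      have h3 := congrArg Complex.re h2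
      rw [← inner_conj_symm] at h3
      simp only [Complex.conj_re, Complex.neg_re] at h3
      change (⟪q.1.1, q.1.2⟫_ℂ).re = 0
      linarith
    have h2 := norm_sub_sq (𝕜 := ℂ) q.1.1 q.1.2
    rw [h1, mul_zero, sub_zero] at h2
    rw [hf, NNReal.coe_one, one_mul]
    change max ‖q.1.1‖ ‖q.1.2‖ ≤ _
    refine max_le ?_ ?_ <;> refine abs_le_of_sq_le_sq' ?_ (norm_nonneg _) |>.2
    · nlinarith [sq_nonneg ‖q.1.2‖]
    · nlinarith [sq_nonneg ‖q.1.1‖]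
  have hclosed : IsClosed (f.range : Set K) := by
    have := hanti.isClosed_range f.uniformContinuous
    exact (LinearMap.coe_range (f : G →ₗ[ℂ] K)).symm ▸ this
  have : CompleteSpace f.range := hclosed.completeSpace_coe
  have htop : f.range = ⊤ := by
    rw [← Submodule.orthogonal_eq_bot_iff, Submodule.eq_bot_iff]
    intro w hw
    refine h.eq_zero_of_inner_eq one_ne_zero fun Φ => ?_
    have h1 := (Submodule.mem_orthogonal' _ _).mp hw _
      (LinearMap.mem_range_self (f : G →ₗ[ℂ] K)
        ⟨_, Submodule.le_topologicalClosure _ (mk_mem_graph_operatorOn C Φ)⟩)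
    change ⟪w, (Φ : K) - (C Φ : K)⟫_ℂ = 0 at h1
    rw [inner_sub_right, sub_eq_zero] at h1
    simp [h1]
  obtain ⟨q, hq⟩ : z ∈ f.range := htop ▸ Submodule.mem_top
  exact ⟨q.1.1, q.1.2, q.2, hq⟩

/-- This is the inclusion of `-C*` in the closure of `C`. Surjectivity provides a pair `(x', y')` of
the closed graph with `x' - y' = x - y`; then `x - x'` lies in the deficiency space with `c = -1`,
which is zero. -/
theorem mem_closure_of_inner (h : AnalyticApprox D C T δ) {x y : K}
    (hxy : ∀ Φ : D, ⟪(C Φ : K), x⟫_ℂ = -⟪(Φ : K), y⟫_ℂ) :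
    (x, y) ∈ (operatorOn D C).graph.topologicalClosure := by
  obtain ⟨x', y', hm, hs⟩ := h.exists_sub_eq (x - y)
  have hz : x - x' = 0 := by
    refine h.eq_zero_of_inner_eq (c := -1) (by norm_num) fun Φ => ?_
    have h1 : ⟪(C Φ : K), x - x'⟫_ℂ = -⟪(Φ : K), x - x'⟫_ℂ := by
      rw [inner_sub_right, hxy, h.inner_of_mem_closure hm]
      have : x - x' = y - y' := by rw [sub_eq_sub_iff_sub_eq_sub, hs]
      rw [this, inner_sub_right]
      ring
    rw [← inner_conj_symm, h1, map_neg, inner_conj_symm]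
    push_cast
    ring
  obtain rfl : x = x' := sub_eq_zero.mp hz
  obtain rfl : y' = y := by simpa using hs
  exact hm

theorem isClosable (h : AnalyticApprox D C T δ) : (operatorOn D C).IsClosable := by
  refine isClosable_iff.mpr fun y hy => ?_
  refine h.dense.eq_zero_of_inner_right ℂ fun Φ hΦ => ?_
  have := h.inner_of_mem_closure hy ⟨Φ, hΦ⟩
  rw [inner_zero_right] at this
  exact neg_eq_zero.mp this.symm

theorem isUnitaryGroupOf (h : AnalyticApprox D C T δ) :
    IsUnitaryGroupOf (operatorOn D C).closure h.group where
  map_zero := h.group_zero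
  map_add := h.group_add
  continuous := h.group_continuous
  generator x y := by
    rw [← h.isClosable.graph_closure_eq_closure_graph]
    -- For the converse, differentiating the constant `⟪U t Φ, U t x⟫` shows that `x` lies in the
    -- domain of the adjoint, with value `-y`.
    refine ⟨h.group_hasDerivAt_of_mem_closure, fun hd => h.mem_closure_of_inner fun Φ => ?_⟩
    have h1 := (h.group_hasDerivAt_zero Φ).inner ℂ hd
    simp only [inner_unitary_coe_apply, h.group_zero] at h1
    have h2 := h1.unique (hasDerivAt_const 0 _)
    rw [add_comm] at h2
    exact eq_neg_of_add_eq_zero_left h2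

theorem isEssentiallySelfAdjoint (h : AnalyticApprox D C T δ) {A : Module.End ℂ D}
    (hA : Complex.I • A = C) : IsEssentiallySelfAdjoint (operatorOn D A) := by
  have hA' : operatorOn D A = Complex.I⁻¹ • operatorOn D C := by
    rw [← operatorOn_smul, ← hA, smul_smul, inv_mul_cancel₀ Complex.I_ne_zero, one_smul]
  have hcl : (operatorOn D A).IsClosable := by
    rw [hA']
    exact isClosable_smul h.isClosable (inv_ne_zero Complex.I_ne_zero)
  refine ⟨h.dense, hcl, ?_⟩
  have hmem : ∀ x y : K, (x, y) ∈ (operatorOn D A).closure.graph ↔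
      (x, Complex.I • y) ∈ (operatorOn D C).graph.topologicalClosure := fun x y => by
    rw [← hcl.graph_closure_eq_closure_graph, ← hA, operatorOn_smul,
      mem_closure_graph_smul_iff _ Complex.I_ne_zero]
  rw [LinearPMap.isSelfAdjoint_def]
  refine LinearPMap.eq_of_eq_graph ?_
  have hd : Dense ((operatorOn D A).closure.domain : Set K) :=
    h.dense.mono (LinearPMap.le_closure _).1
  rw [LinearPMap.adjoint_graph_eq_graph_adjoint hd]
  ext ⟨x, y⟩
  rw [Submodule.mem_adjoint_iff, hmem]
  constructor
  · intro hxy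
    refine h.mem_closure_of_inner fun Φ => ?_
    have h1 := hxy Φ (A Φ) (LinearPMap.le_graph_of_le (LinearPMap.le_closure _)
      (mk_mem_graph_operatorOn A Φ))
    rw [← hA, LinearMap.smul_apply, Submodule.coe_smul, inner_smul_left, inner_smul_right,
      sub_eq_zero.mp h1]
    simp
  · intro hxy a b hab
    rw [hmem] at hab
    have h1 := h.inner_skew_of_mem_closure hxy hab
    rw [inner_smul_left, inner_smul_right, Complex.conj_I, neg_mul, neg_inj] at h1
    rw [mul_left_cancel₀ Complex.I_ne_zero h1, sub_self]

/-! ### Conjugation of eigenvectors of the adjoint action -/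

theorem mul_pow_of_commutator {B : Module.End ℂ D} (hB : C * B - B * C = B) (k : ℕ) :
    B * C ^ k = (C + -1) ^ k * B := by
  have h1 : B * C = (C + -1) * B := by
    ext Φ
    have h2 := congrArg (Subtype.val ∘ fun f : Module.End ℂ D => f Φ) hB
    simp only [Function.comp_apply, LinearMap.sub_apply, Submodule.coe_sub] at h2
    simp only [Module.End.mul_apply, LinearMap.add_apply, LinearMap.neg_apply,
      Module.End.one_apply, Submodule.coe_add, Submodule.coe_neg] at h2 ⊢
    rw [← h2]
    abel
  induction k with
  | zero => simp
  | succ k ih => rw [pow_succ', ← mul_assoc, h1, mul_assoc, ih, ← mul_assoc, ← pow_succ']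

theorem hasSum_smul_antidiagonal {f : ℕ → ℂ} {g : ℕ → K} {a : ℂ} {b : K}
    (hf : Summable fun n => ‖f n‖) (hg : Summable fun n => ‖g n‖) (ha : HasSum f a)
    (hb : HasSum g b) :
    HasSum (fun n => ∑ q ∈ Finset.HasAntidiagonal.antidiagonal n, f q.1 • g q.2) (a • b) := by
  have h3 : Summable fun q : ℕ × ℕ => f q.1 • g q.2 := by
    refine Summable.of_norm ((hf.mul_of_nonneg hg (fun _ => norm_nonneg _)
      fun _ => norm_nonneg _).congr fun q => (norm_smul _ _).symm)
  have h5 := (Finset.HasAntidiagonal.sigmaAntidiagonalEquivProd.hasSum_iff.mpr (ha.smul hb h3)).sigma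
    (fun n => hasSum_fintype _)
  refine h5.congr_fun fun n => ?_
  rw [← Finset.sum_coe_sort]
  rfl

/-- This is `exp (s (C - 1)) = e^{-s} exp (s C)` on analytic vectors: the Cauchy product of the two
series, regrouped by the binomial theorem for the commuting pair `-1`, `C`. -/
theorem hasSum_sub_one_pow (h : AnalyticApprox D C T δ) (Φ : D) {s : ℝ} (hs : |s| < δ) :
    HasSum (fun k : ℕ => ((s : ℂ) ^ k / (k ! : ℂ)) • (((C + -1) ^ k) Φ : K))
      ((Real.exp (-s) : ℂ) • (h.group s : K →L[ℂ] K) Φ) := by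
  have h1 := expSeries_div_hasSum_exp ((-s : ℝ) : ℂ)
  rw [← Complex.exp_eq_exp_ℂ, ← Complex.ofReal_exp] at h1
  refine (hasSum_smul_antidiagonal (norm_expSeries_div_summable ((-s : ℝ) : ℂ))
    (h.summable_norm Φ hs) h1 (h.group_hasSum Φ hs)).congr_fun fun n => ?_
  have hc : Commute (-1 : Module.End ℂ D) C := Commute.neg_one_left C
  rw [add_comm C, hc.add_pow']
  simp only [LinearMap.sum_apply, Submodule.coe_sum, Finset.smul_sum]
  refine Finset.sum_congr rfl fun q hq => ?_
  obtain ⟨i, j⟩ := q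
  obtain rfl := Finset.HasAntidiagonal.mem_antidiagonal.mp hq
  have e : ((-1 : Module.End ℂ D) ^ i) = ((-1 : ℂ) ^ i) • 1 := by
    rw [← one_smul ℂ (1 : Module.End ℂ D), ← neg_smul, smul_pow, one_pow, one_smul]
  rw [e, smul_mul_assoc, one_mul]
  simp only [LinearMap.smul_apply, Submodule.coe_smul, smul_smul, ← Nat.cast_smul_eq_nsmul ℂ]
  congr 1
  rw [Nat.cast_add_choose]
  have := Nat.factorial_ne_zero (i + j)
  push_cast
  field_simp
  rw [pow_add, neg_pow]
  ring

/-- The partial sums of the series of `U s Φ` stay in `D`, and `B` maps them to the partial sums of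
`exp (s (C - 1)) (B Φ)`. Both converge, so the limit pair lies in the closed graph without any
continuity of `B`. -/
theorem mem_closure_of_commutator_of_lt (h : AnalyticApprox D C T δ) {B : Module.End ℂ D}
    (hB : C * B - B * C = B) {s : ℝ} (hs : |s| < δ) {x y : K}
    (hxy : (x, y) ∈ (operatorOn D B).graph.topologicalClosure) :
    ((h.group s : K →L[ℂ] K) x, (Real.exp (-s) : ℂ) • (h.group s : K →L[ℂ] K) y) ∈
      (operatorOn D B).graph.topologicalClosure := by
  refine closure_graph_induction (p := fun q => ((h.group s : K →L[ℂ] K) q.1,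
    (Real.exp (-s) : ℂ) • (h.group s : K →L[ℂ] K) q.2) ∈
      (operatorOn D B).graph.topologicalClosure)
    ((Submodule.isClosed_topologicalClosure _).preimage (by fun_prop)) (fun q hq => ?_) hxy
  obtain ⟨Φ, rfl⟩ := mem_graph_operatorOn.mp hq
  have h1 := (h.group_hasSum Φ hs).tendsto_sum_nat
  have h2 := (h.hasSum_sub_one_pow (B Φ) hs).tendsto_sum_nat
  refine mem_closure_of_tendsto (h1.prodMk_nhds h2) (Eventually.of_forall fun N => ?_)
  refine mem_graph_operatorOn.mpr
    ⟨∑ k ∈ Finset.range N, ((s : ℂ) ^ k / (k ! : ℂ)) • (C ^ k) Φ, ?_⟩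
  simp only [map_sum, map_smul, Submodule.coe_sum, Submodule.coe_smul]
  congr 1
  refine Finset.sum_congr rfl fun k _ => ?_
  rw [← Module.End.mul_apply, mul_pow_of_commutator hB, Module.End.mul_apply]

theorem mem_closure_of_commutator (h : AnalyticApprox D C T δ) {B : Module.End ℂ D}
    (hB : C * B - B * C = B) (s : ℝ) {x y : K}
    (hxy : (x, y) ∈ (operatorOn D B).graph.topologicalClosure) :
    ((h.group s : K →L[ℂ] K) x, (Real.exp (-s) : ℂ) • (h.group s : K →L[ℂ] K) y) ∈
      (operatorOn D B).graph.topologicalClosure := by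
  have hmul : ∀ t : ℝ, |t| < δ → ∀ n : ℕ, ((h.group (n * t) : K →L[ℂ] K) x,
      (Real.exp (-(n * t)) : ℂ) • (h.group (n * t) : K →L[ℂ] K) y) ∈
      (operatorOn D B).graph.topologicalClosure := by
    intro t ht n
    induction n with
    | zero => simpa [h.group_zero] using hxy
    | succ n ih =>
      have e : ((n + 1 : ℕ) : ℝ) * t = t + n * t := by push_cast; ring
      have h1 := h.mem_closure_of_commutator_of_lt hB ht ih
      rw [map_smul, smul_smul, ← Complex.ofReal_mul, ← Real.exp_add, ← neg_add] at h1
      rw [e, h.group_add]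
      exact h1
  obtain ⟨n, hn⟩ := exists_nat_gt (|s| / δ)
  have hn0 : (0 : ℝ) < n := (div_nonneg (abs_nonneg s) h.pos.le).trans_lt hn
  have := hmul (s / n) (by
    rw [abs_div, Nat.abs_cast, div_lt_iff₀ hn0]
    rw [div_lt_iff₀ h.pos] at hn
    linarith) n
  rwa [mul_div_cancel₀ s hn0.ne'] at this

theorem group_neg_mul (h : AnalyticApprox D C T δ) (s : ℝ) :
    h.group (-s) = star (h.group s) := by
  rw [← mul_one (h.group (-s)), ← Unitary.mul_star_self (h.group s), ← mul_assoc, ← h.group_add,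
    neg_add_cancel, h.group_zero, one_mul]

/-- If `[C, B] = B` and the closure of `B` generates the group `W`, then the conjugates of `W`
under the group of `C` are generated by multiples of the closure of `B`. -/
theorem isUnitaryGroupOf_conj (h : AnalyticApprox D C T δ) {B : Module.End ℂ D}
    (hB : C * B - B * C = B) (hBc : (operatorOn D B).IsClosable)
    {W : ℝ → unitary (K →L[ℂ] K)} (hW : IsUnitaryGroupOf (operatorOn D B).closure W) (l : ℝ) :
    IsUnitaryGroupOf (operatorOn D ((Real.exp l : ℂ) • B)).closure
      fun t => h.group l * W t * star (h.group l) where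
  map_zero := by simp [hW.map_zero]
  map_add s t := by
    rw [hW.map_add]
    simp only [mul_assoc]
    rw [← mul_assoc (star (h.group l)) (h.group l), Unitary.star_mul_self, one_mul]
  continuous x := (h.group l : K →L[ℂ] K).continuous.comp
    (hW.continuous (((star (h.group l) : unitary (K →L[ℂ] K)) : K →L[ℂ] K) x))
  generator x y := by
    set E : K →L[ℂ] K := (h.group l : K →L[ℂ] K) with hE
    set F : K →L[ℂ] K := ((star (h.group l) : unitary (K →L[ℂ] K)) : K →L[ℂ] K) with hF
    have hEF : ∀ z, E (F z) = z := fun z =>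
      DFunLike.congr_fun (congrArg Subtype.val (Unitary.mul_star_self (h.group l))) z
    have hFE : ∀ z, F (E z) = z := fun z =>
      DFunLike.congr_fun (congrArg Subtype.val (Unitary.star_mul_self (h.group l))) z
    have he : (Real.exp l : ℂ) ≠ 0 := by exact_mod_cast (Real.exp_pos l).ne'
    have he' : (Real.exp l : ℂ) * (Real.exp (-l) : ℂ) = 1 := by
      rw [← Complex.ofReal_mul, ← Real.exp_add, add_neg_cancel, Real.exp_zero, Complex.ofReal_one]
    have hy : y = (Real.exp l : ℂ) • (Real.exp (-l) : ℂ) • y := by rw [smul_smul, he', one_smul]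
    have h1 : (x, y) ∈ (operatorOn D ((Real.exp l : ℂ) • B)).closure.graph ↔
        (F x, F y) ∈ (operatorOn D B).closure.graph := by
      rw [operatorOn_smul, ← (isClosable_smul hBc he).graph_closure_eq_closure_graph,
        ← hBc.graph_closure_eq_closure_graph]
      -- Splitting off `e^l` from `y` cancels the scalar of `e^l • B`. The transport by time `-l`,
      -- or back by time `l`, then contributes exactly the factor that absorbs the remaining
      -- `e^{-l}`.
      nth_rewrite 1 [hy]
      rw [mem_closure_graph_smul_iff _ he]
      constructor
      · intro hm
        have := h.mem_closure_of_commutator hB (-l) hm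
        rwa [h.group_neg_mul, neg_neg, map_smul, smul_smul, he', one_smul] at this
      · intro hm
        have := h.mem_closure_of_commutator hB l hm
        rwa [← hE, hEF, hEF] at this
    rw [h1, hW.generator]
    constructor
    · intro hd
      have := (E.restrictScalars ℝ).hasFDerivAt.comp_hasDerivAt 0 hd
      refine (this.congr_deriv (hEF y)).congr_of_eventuallyEq (Eventually.of_forall fun s => rfl)
    · intro hd
      have := (F.restrictScalars ℝ).hasFDerivAt.comp_hasDerivAt 0 hd
      refine this.congr_of_eventuallyEq (Eventually.of_forall fun s => ?_)
      exact (hFE _).symm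

end AnalyticApprox

end Generators

/-! ## Truncated creation and annihilation operators -/

section Truncation

variable {G : ℕ → Type u} [∀ n, NormedAddCommGroup (G n)] [∀ n, InnerProductSpace ℂ (G n)]
  [∀ n, CompleteSpace (G n)] {c : ∀ n, G n →L[ℂ] G (n + 1)} {b : ℝ}

theorem hasSum_norm_sq (x : lp G 2) : HasSum (fun n => ‖x n‖ ^ 2) (‖x‖ ^ 2) := by
  have := lp.hasSum_norm (p := 2) (by norm_num) x
  simpa using this

theorem norm_le_of_raising {x y : lp G 2} {q : ℝ} (hq : 0 ≤ q) (h0 : y 0 = 0)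
    (h : ∀ n, ‖y (n + 1)‖ ≤ q * ‖x n‖) : ‖y‖ ≤ q * ‖x‖ := by
  refine (abs_le_of_sq_le_sq' ?_ (by positivity)).2
  have h1 := (hasSum_nat_add_iff' 1).mpr (hasSum_norm_sq y)
  simp only [Finset.sum_range_one, h0, norm_zero, zero_pow two_ne_zero, sub_zero] at h1
  rw [mul_pow]
  refine hasSum_le (fun n => ?_) h1 ((hasSum_norm_sq x).mul_left (q ^ 2))
  rw [← mul_pow]
  gcongr
  exact h n

theorem norm_le_of_lowering {x y : lp G 2} {q : ℝ} (hq : 0 ≤ q)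
    (h : ∀ n, ‖y n‖ ≤ q * ‖x (n + 1)‖) : ‖y‖ ≤ q * ‖x‖ := by
  refine (abs_le_of_sq_le_sq' ?_ (by positivity)).2
  have h1 := (hasSum_nat_add_iff' 1).mpr (hasSum_norm_sq x)
  simp only [Finset.sum_range_one] at h1
  rw [mul_pow]
  refine (hasSum_le (fun n => ?_) (hasSum_norm_sq y) (h1.mul_left (q ^ 2))).trans ?_
  · rw [← mul_pow]
    gcongr
    exact h n
  · gcongr
    linarith [sq_nonneg ‖x 0‖]

/-- The inclusion of the `n`-particle space into Fock space. -/
def incl (G : ℕ → Type u) [∀ n, NormedAddCommGroup (G n)] [∀ n, InnerProductSpace ℂ (G n)] (n : ℕ) :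
    G n →L[ℂ] lp G 2 :=
  lp.singleContinuousLinearMap ℂ G 2 n

/-- The projection of Fock space onto the `n`-particle space. -/
def proj (G : ℕ → Type u) [∀ n, NormedAddCommGroup (G n)] [∀ n, InnerProductSpace ℂ (G n)] (n : ℕ) :
    lp G 2 →L[ℂ] G n :=
  lp.evalCLM ℂ G 2 n

theorem proj_apply (n : ℕ) (x : lp G 2) : proj G n x = x n := rfl

theorem inner_incl_left (n : ℕ) (a : G n) (x : lp G 2) :
    ⟪incl G n a, x⟫_ℂ = ⟪a, x n⟫_ℂ :=
  lp.inner_single_left n a x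

theorem inner_incl_right (n : ℕ) (a : G n) (x : lp G 2) :
    ⟪x, incl G n a⟫_ℂ = ⟪x n, a⟫_ℂ :=
  lp.inner_single_right n a x

/-- The creation operator on the `n`-particle spaces with `n < N`, and zero on the others. -/
def truncRaise (c : ∀ n, G n →L[ℂ] G (n + 1)) (N : ℕ) : lp G 2 →L[ℂ] lp G 2 :=
  ∑ n ∈ Finset.range N, incl G (n + 1) ∘L c n ∘L proj G n

/-- The annihilation operator on the `n`-particle spaces with `n ≤ N`, and zero on the others. -/
def truncLower (c : ∀ n, G n →L[ℂ] G (n + 1)) (N : ℕ) : lp G 2 →L[ℂ] lp G 2 :=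
  ∑ n ∈ Finset.range N, incl G n ∘L ContinuousLinearMap.adjoint (c n) ∘L proj G (n + 1)

theorem star_truncRaise (c : ∀ n, G n →L[ℂ] G (n + 1)) (N : ℕ) :
    star (truncRaise c N) = truncLower c N := by
  rw [ContinuousLinearMap.star_eq_adjoint, eq_comm, ContinuousLinearMap.eq_adjoint_iff]
  intro x y
  simp only [truncRaise, truncLower, sum_apply, ContinuousLinearMap.comp_apply, sum_inner,
    inner_sum, inner_incl_left, inner_incl_right, proj_apply,
    ContinuousLinearMap.adjoint_inner_left]

theorem star_truncLower (c : ∀ n, G n →L[ℂ] G (n + 1)) (N : ℕ) :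
    star (truncLower c N) = truncRaise c N := by
  rw [← star_truncRaise, star_star]

theorem incl_apply_self (n : ℕ) (a : G n) : incl G n a n = a :=
  lp.single_apply_self _ _ _

theorem incl_apply_ne {n m : ℕ} (a : G n) (h : m ≠ n) : incl G n a m = 0 :=
  lp.single_apply_ne _ _ _ h

theorem sum_lp_apply {ι : Type*} (s : Finset ι) (f : ι → lp G 2) (m : ℕ) :
    (∑ i ∈ s, f i : lp G 2) m = ∑ i ∈ s, f i m := by
  rw [← proj_apply, map_sum]
  rfl

theorem truncRaise_zero (c : ∀ n, G n →L[ℂ] G (n + 1)) (N : ℕ) (x : lp G 2) : truncRaise c N x 0 = 0 := by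
  rw [truncRaise, sum_apply, sum_lp_apply]
  exact Finset.sum_eq_zero fun n _ => incl_apply_ne _ (Nat.succ_ne_zero n).symm

theorem truncRaise_succ (c : ∀ n, G n →L[ℂ] G (n + 1)) (N : ℕ) (x : lp G 2) (m : ℕ) :
    truncRaise c N x (m + 1) = if m < N then c m (x m) else 0 := by
  rw [truncRaise, sum_apply, sum_lp_apply]
  split_ifs with h
  · rw [Finset.sum_eq_single_of_mem m (Finset.mem_range.mpr h) fun n _ hn =>
      incl_apply_ne _ (by omega)]
    exact incl_apply_self _ _
  · refine Finset.sum_eq_zero fun n hn => incl_apply_ne _ ?_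
    have := Finset.mem_range.mp hn
    omega

theorem truncLower_apply (c : ∀ n, G n →L[ℂ] G (n + 1)) (N : ℕ) (x : lp G 2) (m : ℕ) :
    truncLower c N x m = if m < N then ContinuousLinearMap.adjoint (c m) (x (m + 1)) else 0 := by
  rw [truncLower, sum_apply, sum_lp_apply]
  split_ifs with h
  · rw [Finset.sum_eq_single_of_mem m (Finset.mem_range.mpr h) fun n _ hn =>
      incl_apply_ne _ hn.symm]
    exact incl_apply_self _ _
  · refine Finset.sum_eq_zero fun n hn => incl_apply_ne _ ?_
    have := Finset.mem_range.mp hn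
    omega

/-- The vectors with at most `m` particles. -/
def levelLE (G : ℕ → Type u) [∀ n, NormedAddCommGroup (G n)] [∀ n, InnerProductSpace ℂ (G n)] (m : ℕ) :
    Submodule ℂ (lp G 2) where
  carrier := {x | ∀ n, m < n → x n = 0}
  zero_mem' _ _ := rfl
  add_mem' {x y} hx hy n hn := by
    change x n + y n = 0
    rw [hx n hn, hy n hn, add_zero]
  smul_mem' c x hx n hn := by
    change c • x n = 0
    rw [hx n hn, smul_zero]

theorem levelLE_mono {m n : ℕ} (h : m ≤ n) : levelLE G m ≤ levelLE G n :=
  fun _ hx k hk => hx k (h.trans_lt hk)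

theorem dense_of_incl_mem {D : Submodule ℂ (lp G 2)} (hD : ∀ n a, incl G n a ∈ D) :
    Dense (D : Set (lp G 2)) := by
  intro x
  have h := (lp.hasSum_single (p := 2) (by norm_num) x).tendsto_sum_nat
  exact mem_closure_of_tendsto h (Eventually.of_forall fun N =>
    Submodule.sum_mem _ fun n _ => hD n (x n))

theorem truncRaise_mem_levelLE (c : ∀ n, G n →L[ℂ] G (n + 1)) (N : ℕ) {m : ℕ} {x : lp G 2} (hx : x ∈ levelLE G m) :
    truncRaise c N x ∈ levelLE G (m + 1) := by
  rintro (_ | n) hn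
  · omega
  · rw [truncRaise_succ, hx n (by omega)]
    simp

theorem truncLower_mem_levelLE (c : ∀ n, G n →L[ℂ] G (n + 1)) (N : ℕ) {m : ℕ} {x : lp G 2}
    (hx : x ∈ levelLE G m) : truncLower c N x ∈ levelLE G m := by
  intro n hn
  rw [truncLower_apply, hx (n + 1) (by omega)]
  simp

/-- Different sectors are mapped to orthogonal sectors, so the largest norm among the sectors `n ≤
m` suffices. The bound depends on the level of `x` and not on the cutoff `N`. -/
theorem norm_truncRaise_le (hb0 : 0 ≤ b) (hb : ∀ n, ‖c n‖ ≤ √(n + 1) * b) (N : ℕ) {m : ℕ} {x : lp G 2} (hx : x ∈ levelLE G m) :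
    ‖truncRaise c N x‖ ≤ √(m + 1) * b * ‖x‖ := by
  refine norm_le_of_raising (by positivity) (truncRaise_zero c N x) fun n => ?_
  rw [truncRaise_succ]
  split_ifs
  · rcases le_or_gt n m with h | h
    · refine (ContinuousLinearMap.le_opNorm _ _).trans ?_
      have := hb n
      gcongr
      refine this.trans ?_
      gcongr
    · simp [hx n h]
  · simp only [norm_zero]
    positivity

theorem norm_truncLower_le (hb0 : 0 ≤ b) (hb : ∀ n, ‖c n‖ ≤ √(n + 1) * b) (N : ℕ) {m : ℕ} {x : lp G 2} (hx : x ∈ levelLE G m) :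
    ‖truncLower c N x‖ ≤ √m * b * ‖x‖ := by
  refine norm_le_of_lowering (by positivity) fun n => ?_
  rw [truncLower_apply]
  split_ifs
  · rcases le_or_gt (n + 1) m with h | h
    · refine (ContinuousLinearMap.le_opNorm _ _).trans ?_
      have : ‖ContinuousLinearMap.adjoint (c n)‖ ≤ √(n + 1) * b := by
        rw [LinearIsometryEquiv.norm_map]
        exact hb n
      gcongr
      refine this.trans ?_
      gcongr
      exact_mod_cast h
    · simp [hx (n + 1) h]
  · simp only [norm_zero]
    positivity

theorem truncRaise_eq (c : ∀ n, G n →L[ℂ] G (n + 1)) {N m : ℕ} (hN : m < N) {x y : lp G 2}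
    (hx : x ∈ levelLE G m) (h0 : y 0 = 0) (hy : ∀ n, y (n + 1) = c n (x n)) :
    truncRaise c N x = y := by
  refine lp.ext (funext fun n => ?_)
  cases n with
  | zero => rw [truncRaise_zero, h0]
  | succ n =>
    rw [truncRaise_succ, hy]
    split_ifs with h
    · rfl
    · rw [hx n (by omega), map_zero]

theorem truncLower_eq (c : ∀ n, G n →L[ℂ] G (n + 1)) {N m : ℕ} (hN : m < N) {x y : lp G 2}
    (hx : x ∈ levelLE G m) (hy : ∀ n, y n = ContinuousLinearMap.adjoint (c n) (x (n + 1))) :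
    truncLower c N x = y := by
  refine lp.ext (funext fun n => ?_)
  rw [truncLower_apply, hy]
  split_ifs with h
  · rfl
  · rw [hx (n + 1) (by omega), map_zero]

/-! ### Operators of linear growth -/

/-- After `j` applications the vector has level at most `m + d * j`, which yields the `j`-th factor.
-/
theorem norm_pow_le_of_growth {T : lp G 2 →L[ℂ] lp G 2} {c : ℝ} {d : ℕ} (hc : 0 ≤ c)
    (hl : ∀ m, ∀ x ∈ levelLE G m, T x ∈ levelLE G (m + d))
    (hn : ∀ m, ∀ x ∈ levelLE G m, ‖T x‖ ≤ c * (m + 1) * ‖x‖) (k : ℕ) {m : ℕ} {x : lp G 2}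
    (hx : x ∈ levelLE G m) :
    ‖(T ^ k) x‖ ≤ (∏ j ∈ Finset.range k, c * (m + d * j + 1)) * ‖x‖ := by
  induction k generalizing m x with
  | zero => simp
  | succ k ih =>
    rw [pow_succ, mul_apply_eq_comp, Finset.prod_range_succ']
    refine (ih (hl m x hx)).trans ?_
    rw [mul_assoc]
    have h1 := hn m x hx
    have e : ∀ j : ℕ, c * (((m + d : ℕ) : ℝ) + d * j + 1) = c * (m + d * ((j + 1 : ℕ) : ℝ) + 1) :=
      fun j => by push_cast; ring
    simp only [e, Nat.cast_zero, mul_zero, add_zero]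
    gcongr

/-- Ratio test: the quotient of consecutive terms is `r c (m + d k + 1) / (k + 1)`, with limit `r c
d`. -/
theorem summable_growth {c r : ℝ} (hc : 0 ≤ c) (hr : 0 ≤ r) (d m : ℕ) (hd : r * c * d < 1)
    (a : ℝ) : Summable fun k : ℕ =>
      r ^ k / (k ! : ℝ) * ((∏ j ∈ Finset.range k, c * (m + d * j + 1)) * a) := by
  have hlim : Tendsto (fun k : ℕ => r * c * (((m : ℝ) + 1 - d) * (1 / ((k : ℝ) + 1)) + d)) atTop
      (𝓝 (r * c * d)) := by
    have := ((tendsto_one_div_add_atTop_nhds_zero_nat (𝕜 := ℝ)).const_mul ((m : ℝ) + 1 - d)).add_const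
      (d : ℝ)
    rw [mul_zero, zero_add] at this
    exact this.const_mul _
  obtain ⟨q, hq, hq1⟩ := exists_between hd
  refine summable_of_ratio_norm_eventually_le hq1 ?_
  filter_upwards [hlim.eventually_le_const hq] with k hk
  have e : r ^ (k + 1) / ((k + 1)! : ℝ) *
      ((∏ j ∈ Finset.range (k + 1), c * (m + d * j + 1)) * a) =
      (r * c * (((m : ℝ) + 1 - d) * (1 / ((k : ℝ) + 1)) + d)) *
      (r ^ k / (k ! : ℝ) * ((∏ j ∈ Finset.range k, c * (m + d * j + 1)) * a)) := by
    rw [Finset.prod_range_succ, Nat.factorial_succ]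
    push_cast
    field_simp
    ring
  rw [e, norm_mul]
  gcongr
  rw [Real.norm_eq_abs, abs_of_nonneg]
  · exact hk
  · have : ((m : ℝ) + 1 - d) * (1 / ((k : ℝ) + 1)) + d = (m + d * k + 1) / (k + 1) := by
      field_simp
      ring
    rw [this]
    positivity

theorem analyticApprox_of_growth {D : Submodule ℂ (lp G 2)} (hD : Dense (D : Set (lp G 2)))
    (hDl : ∀ Φ : D, ∃ m, (Φ : lp G 2) ∈ levelLE G m) {C : Module.End ℂ D}
    {T : ℕ → lp G 2 →L[ℂ] lp G 2} {c δ : ℝ} {d : ℕ} (hc : 0 ≤ c) (hδ : 0 < δ)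
    (hcd : ∀ r, 0 ≤ r → r < δ → r * c * d < 1) (hs : ∀ N, star (T N) = -T N)
    (hT : ∀ Φ : D, ∀ᶠ N in atTop, T N Φ = C Φ)
    (hl : ∀ N m, ∀ x ∈ levelLE G m, T N x ∈ levelLE G (m + d))
    (hn : ∀ N m, ∀ x ∈ levelLE G m, ‖T N x‖ ≤ c * (m + 1) * ‖x‖) :
    AnalyticApprox D C T δ where
  dense := hD
  pos := hδ
  skew := hs
  eventually_eq := hT
  bound Φ r hr hr' := by
    obtain ⟨m, hm⟩ := hDl Φ
    exact ⟨_, summable_growth hc hr d m (hcd r hr hr') ‖(Φ : lp G 2)‖, fun N k =>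
      norm_pow_le_of_growth hc (hl N) (hn N) k hm⟩

theorem sqrt_le_add_one (m : ℕ) : √(m : ℝ) ≤ m + 1 := by
  rw [Real.sqrt_le_left (by positivity)]
  nlinarith [(Nat.cast_nonneg m : (0 : ℝ) ≤ m)]

theorem sqrt_add_one_le (m : ℕ) : √((m : ℝ) + 1) ≤ m + 1 := by
  rw [Real.sqrt_le_left (by positivity)]
  nlinarith [(Nat.cast_nonneg m : (0 : ℝ) ≤ m)]

theorem analyticApprox_lower_sub_raise (hb0 : 0 ≤ b) (hb : ∀ n, ‖c n‖ ≤ √(n + 1) * b)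
    {D : Submodule ℂ (lp G 2)} (hD : Dense (D : Set (lp G 2)))
    (hDl : ∀ Φ : D, ∃ m, (Φ : lp G 2) ∈ levelLE G m) {R L : Module.End ℂ D}
    (hR : ∀ Φ : D, ∀ᶠ N in atTop, truncRaise c N Φ = R Φ)
    (hL : ∀ Φ : D, ∀ᶠ N in atTop, truncLower c N Φ = L Φ) :
    AnalyticApprox D (L - R) (fun N => truncLower c N - truncRaise c N) (1 / (2 * b + 1)) := by
  -- The crude estimate `√m, √(m + 1) ≤ m + 1` already gives linear growth with `c = 2 b`. The `+ 1`
  -- in the radius keeps it positive when `b = 0`.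
  refine analyticApprox_of_growth hD hDl (c := 2 * b) (d := 1) (by positivity) (by positivity)
    (fun r hr hr' => ?_) (fun N => ?_) (fun Φ => ?_) (fun N m x hx => ?_) fun N m x hx => ?_
  · rw [lt_div_iff₀ (by positivity)] at hr'
    push_cast
    nlinarith
  · rw [star_sub, star_truncLower, star_truncRaise, neg_sub]
  · filter_upwards [hR Φ, hL Φ]
      with N h1 h2
    rw [sub_apply, h1, h2]
    rfl
  · exact Submodule.sub_mem _ (levelLE_mono (Nat.le_succ m) (truncLower_mem_levelLE c N hx))
      (truncRaise_mem_levelLE c N hx)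
  · calc _ ≤ ‖truncLower c N x‖ + ‖truncRaise c N x‖ := norm_sub_le _ _
      _ ≤ √m * b * ‖x‖ + √(m + 1) * b * ‖x‖ :=
        add_le_add (norm_truncLower_le hb0 hb N hx) (norm_truncRaise_le hb0 hb N hx)
      _ ≤ (m + 1) * b * ‖x‖ + (m + 1) * b * ‖x‖ := by
        gcongr
        · exact sqrt_le_add_one m
        · exact sqrt_add_one_le m
      _ = _ := by ring

theorem norm_truncRaise_sq_le (hb0 : 0 ≤ b) (hb : ∀ n, ‖c n‖ ≤ √(n + 1) * b) (N : ℕ) {m : ℕ} {x : lp G 2} (hx : x ∈ levelLE G m) :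
    ‖truncRaise c N (truncRaise c N x)‖ ≤ (m + 2) * b ^ 2 * ‖x‖ := by
  calc _ ≤ √((m + 1 : ℕ) + 1) * b * ‖truncRaise c N x‖ :=
        norm_truncRaise_le hb0 hb N (truncRaise_mem_levelLE c N hx)
    _ ≤ √((m + 1 : ℕ) + 1) * b * (√((m + 1 : ℕ) + 1) * b * ‖x‖) := by
        gcongr
        refine (norm_truncRaise_le hb0 hb N hx).trans ?_
        gcongr
        push_cast
        linarith
    _ = √((m + 1 : ℕ) + 1) ^ 2 * b ^ 2 * ‖x‖ := by ring
    _ = (m + 2) * b ^ 2 * ‖x‖ := by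
        rw [Real.sq_sqrt (by positivity)]
        push_cast
        ring

theorem norm_truncLower_sq_le (hb0 : 0 ≤ b) (hb : ∀ n, ‖c n‖ ≤ √(n + 1) * b) (N : ℕ) {m : ℕ} {x : lp G 2}
    (hx : x ∈ levelLE G m) :
    ‖truncLower c N (truncLower c N x)‖ ≤ m * b ^ 2 * ‖x‖ := by
  calc _ ≤ √m * b * ‖truncLower c N x‖ :=
        norm_truncLower_le hb0 hb N (truncLower_mem_levelLE c N hx)
    _ ≤ √m * b * (√m * b * ‖x‖) := by
        gcongr
        exact norm_truncLower_le hb0 hb N hx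
    _ = √m ^ 2 * b ^ 2 * ‖x‖ := by ring
    _ = _ := by rw [Real.sq_sqrt (by positivity)]

theorem analyticApprox_raise_sq_sub_lower_sq (hb : ∀ n, ‖c n‖ ≤ √(n + 1) * 1)
    {D : Submodule ℂ (lp G 2)} (hD : Dense (D : Set (lp G 2)))
    (hDl : ∀ Φ : D, ∃ m, (Φ : lp G 2) ∈ levelLE G m) {R L : Module.End ℂ D}
    (hR : ∀ Φ : D, ∀ᶠ N in atTop, truncRaise c N Φ = R Φ)
    (hL : ∀ Φ : D, ∀ᶠ N in atTop, truncLower c N Φ = L Φ) :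
    AnalyticApprox D ((1 / 2 : ℂ) • (R ^ 2 - L ^ 2))
      (fun N => (1 / 2 : ℂ) • (truncRaise c N ^ 2 - truncLower c N ^ 2)) (1 / 2) := by
  -- The two squares contribute `m + 2` and `m`, and half their sum is `m + 1`. So `c = 1`, while `d
  -- = 2` counts the two created particles.
  refine analyticApprox_of_growth hD hDl (c := 1) (d := 2) (by positivity) (by positivity)
    (fun r hr hr' => ?_) (fun N => ?_) (fun Φ => ?_) (fun N m x hx => ?_) fun N m x hx => ?_
  · push_cast
    linarith
  · rw [star_smul, star_sub, star_pow, star_pow, star_truncLower, star_truncRaise,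
      ← neg_sub, smul_neg]
    simp
  · filter_upwards [hR Φ, hL Φ, hR (R Φ), hL (L Φ)] with N h1 h2 h3 h4
    rw [smul_apply, sub_apply, pow_two, pow_two, mul_apply_eq_comp,
      mul_apply_eq_comp, h1, h2, h3, h4]
    rfl
  · rw [smul_apply, sub_apply, pow_two, pow_two, mul_apply_eq_comp, mul_apply_eq_comp]
    refine Submodule.smul_mem _ _ (Submodule.sub_mem _ ?_ ?_)
    · exact truncRaise_mem_levelLE c N (truncRaise_mem_levelLE c N hx)
    · exact levelLE_mono (Nat.le_add_right m 2)
        (truncLower_mem_levelLE c N (truncLower_mem_levelLE c N hx))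
  · rw [smul_apply, sub_apply, pow_two, pow_two, mul_apply_eq_comp, mul_apply_eq_comp, norm_smul]
    have h1 := norm_truncRaise_sq_le zero_le_one hb N hx
    have h2 := norm_truncLower_sq_le zero_le_one hb N hx
    have h3 := norm_sub_le (truncRaise c N (truncRaise c N x))
      (truncLower c N (truncLower c N x))
    norm_num at h1 h2 ⊢
    linarith

end Truncation

/-! ## Symmetrised elementary tensors -/

section SymmetricTensors

variable {H : Type u} [NormedAddCommGroup H] [InnerProductSpace ℂ H]

/-- The symmetrised elementary tensor `S (x 0 ⊗ ⋯ ⊗ x (n - 1))`. -/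
def symTensor {n : ℕ} (x : Fin n → H) : symPow H n :=
  symmetrize H n (tmk n x : HilbertTensorPow H n)

theorem sum_perm_mem_symPow {n : ℕ} (x : Fin n → H) :
    ((∑ σ : Equiv.Perm (Fin n), tmk n (x ∘ σ) : TensorPow H n) : HilbertTensorPow H n) ∈
      symPow H n :=
  Submodule.le_topologicalClosure _ (Submodule.subset_span ⟨x, rfl⟩)

theorem symmetrize_of_mem {n : ℕ} {v : HilbertTensorPow H n} (hv : v ∈ symPow H n) :
    symmetrize H n v = ⟨v, hv⟩ :=
  Submodule.orthogonalProjectionOnto_mem_subspace_eq_self (⟨v, hv⟩ : symPow H n)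

theorem inner_coe_symmetrize {n : ℕ} (u : symPow H n) (v : HilbertTensorPow H n) :
    ⟪(u : HilbertTensorPow H n), (symmetrize H n v : HilbertTensorPow H n)⟫_ℂ =
      ⟪(u : HilbertTensorPow H n), v⟫_ℂ :=
  Submodule.inner_orthogonalProjectionOnto_eq_of_mem_left (K := symPow H n) u v

theorem coe_sum_tensor {n : ℕ} {ι : Type*} (s : Finset ι) (f : ι → TensorPow H n) :
    ((∑ i ∈ s, f i : TensorPow H n) : HilbertTensorPow H n) =
      ∑ i ∈ s, (f i : HilbertTensorPow H n) :=
  map_sum (UniformSpace.Completion.toComplL (𝕜 := ℂ) (E := TensorPow H n)) f s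

/-- Two vectors of the symmetric tensor power with the same inner products with the symmetric
sums of elementary tensors are equal. -/
theorem symPow_ext_sum {n : ℕ} {u v : symPow H n}
    (h : ∀ x : Fin n → H, ⟪((∑ σ : Equiv.Perm (Fin n), tmk n (x ∘ σ) : TensorPow H n) :
      HilbertTensorPow H n), (u : HilbertTensorPow H n)⟫_ℂ =
      ⟪((∑ σ : Equiv.Perm (Fin n), tmk n (x ∘ σ) : TensorPow H n) :
      HilbertTensorPow H n), (v : HilbertTensorPow H n)⟫_ℂ) : u = v := by
  have h1 : ((u : HilbertTensorPow H n) - v) ∈ (symPow H n)ᗮ := by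
    have h0 : (symPow H n)ᗮ = (Submodule.span ℂ (Set.range fun x : Fin n → H =>
        ((∑ σ : Equiv.Perm (Fin n), tmk n (x ∘ σ) : TensorPow H n) : HilbertTensorPow H n)))ᗮ :=
      Submodule.orthogonal_closure _
    rw [h0, Submodule.mem_orthogonal]
    intro w hw
    induction hw using Submodule.span_induction with
    | mem w hw =>
      obtain ⟨x, rfl⟩ := hw
      rw [inner_sub_right, h, sub_self]
    | zero => exact inner_zero_left _
    | add a b _ _ ha hb => rw [inner_add_left, ha, hb, add_zero]
    | smul c a _ ha => rw [inner_smul_left, ha, mul_zero]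
  have h2 : ((u : HilbertTensorPow H n) - v) ∈ symPow H n := Submodule.sub_mem _ u.2 v.2
  have h3 : (u : HilbertTensorPow H n) - v = 0 := by
    rw [← inner_self_eq_zero (𝕜 := ℂ)]
    exact (Submodule.mem_orthogonal _ _).mp h1 _ h2
  exact Subtype.ext (sub_eq_zero.mp h3)

/-- Reindex the sum by `σ ↦ σ * τ` and each product by `τ`. -/
theorem inner_sum_perm_tmk {n : ℕ} (x y : Fin n → H) (τ : Equiv.Perm (Fin n)) :
    ⟪(∑ σ : Equiv.Perm (Fin n), tmk n (x ∘ σ) : TensorPow H n), tmk n (y ∘ τ)⟫_ℂ =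
      ⟪(∑ σ : Equiv.Perm (Fin n), tmk n (x ∘ σ) : TensorPow H n), tmk n y⟫_ℂ := by
  simp only [sum_inner, inner_eq_tinner, tinner_tmk]
  rw [← Equiv.sum_comp (Equiv.mulRight τ)]
  refine Finset.sum_congr rfl fun σ _ => ?_
  exact Equiv.prod_comp τ fun i => ⟪(x ∘ σ) i, y i⟫_ℂ

theorem symTensor_perm {n : ℕ} (x : Fin n → H) (τ : Equiv.Perm (Fin n)) :
    symTensor (x ∘ τ) = symTensor x := by
  refine symPow_ext_sum fun y => ?_
  have h1 := inner_coe_symmetrize ⟨_, sum_perm_mem_symPow y⟩ (tmk n (x ∘ τ) : HilbertTensorPow H n)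
  have h2 := inner_coe_symmetrize ⟨_, sum_perm_mem_symPow y⟩ (tmk n x : HilbertTensorPow H n)
  refine h1.trans (Eq.trans ?_ h2.symm)
  rw [UniformSpace.Completion.inner_coe, UniformSpace.Completion.inner_coe, inner_sum_perm_tmk]

/-- This identifies the orthogonal projection with averaging over permutations: the sum is fixed by
the projection, while its `n!` terms all have the same projection. -/
theorem sum_perm_eq_symTensor {n : ℕ} (x : Fin n → H) :
    ((∑ σ : Equiv.Perm (Fin n), tmk n (x ∘ σ) : TensorPow H n) : HilbertTensorPow H n) =
      (n ! : ℂ) • (symTensor x : HilbertTensorPow H n) := by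
  have h1 := congrArg Subtype.val (symmetrize_of_mem (sum_perm_mem_symPow x))
  refine h1.symm.trans ?_
  rw [coe_sum_tensor, map_sum]
  have h2 : ∀ σ : Equiv.Perm (Fin n),
      symmetrize H n (tmk n (x ∘ σ) : HilbertTensorPow H n) = symTensor x :=
    fun σ => symTensor_perm x σ
  simp only [h2, Finset.sum_const, Finset.card_univ, Fintype.card_perm, Fintype.card_fin]
  rw [Nat.cast_smul_eq_nsmul]
  rfl

theorem symTensor_mem_closure_span {n : ℕ} (v : symPow H n) :
    (v : HilbertTensorPow H n) ∈ (Submodule.span ℂ (Set.range fun x : Fin n → H =>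
      (symTensor x : HilbertTensorPow H n))).topologicalClosure := by
  refine Submodule.topologicalClosure_mono (Submodule.span_le.mpr ?_) v.2
  rintro _ ⟨x, rfl⟩
  simp only [sum_perm_eq_symTensor]
  exact Submodule.smul_mem _ _ (Submodule.subset_span ⟨x, rfl⟩)

theorem symPow_induction {n : ℕ} {p : symPow H n → Prop} (hc : IsClosed {v | p v})
    (h0 : ∀ x, p (symTensor x)) (ha : ∀ u v, p u → p v → p (u + v))
    (hs : ∀ (c : ℂ) u, p u → p (c • u)) (v : symPow H n) : p v := by
  -- The predicate becomes a closed subspace of the ambient Hilbert space, where the span of the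
  -- symmetrised tensors and its closure live.
  let q : Submodule ℂ (HilbertTensorPow H n) :=
    { carrier := {w | ∃ hw : w ∈ symPow H n, p ⟨w, hw⟩}
      zero_mem' := ⟨Submodule.zero_mem _, by
        have := hs 0 _ (h0 0)
        rwa [zero_smul] at this⟩
      add_mem' := fun {a b} ⟨ha', ha''⟩ ⟨hb', hb''⟩ =>
        ⟨Submodule.add_mem _ ha' hb', ha _ _ ha'' hb''⟩
      smul_mem' := fun c a ⟨ha', ha''⟩ => ⟨Submodule.smul_mem _ c ha', hs c _ ha''⟩ }
  have hq : IsClosed (q : Set (HilbertTensorPow H n)) := by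
    have h1 : IsClosed (symPow H n : Set (HilbertTensorPow H n)) :=
      Submodule.isClosed_topologicalClosure _
    have h2 := h1.isClosedEmbedding_subtypeVal.isClosedMap _ hc
    convert h2 using 1
    ext w
    constructor
    · rintro ⟨hw, hp⟩
      exact ⟨⟨w, hw⟩, hp, rfl⟩
    · rintro ⟨w', hp, rfl⟩
      exact ⟨w'.2, hp⟩
  have h3 : Submodule.span ℂ (Set.range fun x : Fin n → H =>
      (symTensor x : HilbertTensorPow H n)) ≤ q := by
    rw [Submodule.span_le]
    rintro _ ⟨x, rfl⟩
    exact ⟨(symTensor x).2, h0 x⟩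
  obtain ⟨_, hp⟩ := Submodule.topologicalClosure_minimal _ h3 hq (symTensor_mem_closure_span v)
  exact hp

theorem symPow_ext {n : ℕ} {u v : symPow H n}
    (h : ∀ x : Fin n → H, ⟪(symTensor x : HilbertTensorPow H n), (u : HilbertTensorPow H n)⟫_ℂ =
      ⟪(symTensor x : HilbertTensorPow H n), (v : HilbertTensorPow H n)⟫_ℂ) : u = v :=
  symPow_ext_sum fun x => by rw [sum_perm_eq_symTensor, inner_smul_left, inner_smul_left, h]

/-- Self-adjointness of the projection removes one symmetrisation; expanding the other gives the
permanent of the Gram matrix. -/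
theorem factorial_mul_inner_symTensor {n : ℕ} (x y : Fin n → H) :
    (n ! : ℂ) * ⟪(symTensor x : HilbertTensorPow H n), (symTensor y : HilbertTensorPow H n)⟫_ℂ =
      ∑ σ : Equiv.Perm (Fin n), ∏ i, ⟪x i, y (σ i)⟫_ℂ := by
  have h2 : ⟪((∑ σ : Equiv.Perm (Fin n), tmk n (y ∘ σ) : TensorPow H n) : HilbertTensorPow H n),
      (symTensor x : HilbertTensorPow H n)⟫_ℂ =
      ⟪((∑ σ : Equiv.Perm (Fin n), tmk n (y ∘ σ) : TensorPow H n) : HilbertTensorPow H n),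
      (tmk n x : HilbertTensorPow H n)⟫_ℂ :=
    inner_coe_symmetrize ⟨_, sum_perm_mem_symPow y⟩ (tmk n x : HilbertTensorPow H n)
  have h3 := congrArg conj h2
  rw [inner_conj_symm, inner_conj_symm, sum_perm_eq_symTensor, inner_smul_right] at h3
  rw [h3, ← sum_perm_eq_symTensor, UniformSpace.Completion.inner_coe]
  simp only [inner_sum, inner_eq_tinner, tinner_tmk, Function.comp_apply]

/-! ### Creation and annihilation of symmetrised elementary tensors -/

theorem norm_tensorLeft_apply_le (n : ℕ) (ψ : H) (v : HilbertTensorPow H n) :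
    ‖tensorLeft n ψ v‖ ≤ ‖ψ‖ * ‖v‖ := by
  refine UniformSpace.Completion.induction_on v (isClosed_le (by fun_prop) (by fun_prop))
    fun t => ?_
  rw [tensorLeft, ContinuousLinearMap.completion_apply_coe, UniformSpace.Completion.norm_coe,
    UniformSpace.Completion.norm_coe]
  exact (norm_tcons ψ t).le

theorem tensorLeft_tmk {n : ℕ} (ψ : H) (x : Fin n → H) :
    tensorLeft n ψ (tmk n x : HilbertTensorPow H n) =
      (tmk (n + 1) (Fin.cons ψ x : Fin (n + 1) → H) : HilbertTensorPow H (n + 1)) := by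
  rw [tensorLeft, ContinuousLinearMap.completion_apply_coe]
  exact congrArg _ (tcons_tmk ψ x)

theorem creationAt_apply (n : ℕ) (ψ : H) (v : symPow H n) :
    creationAt n ψ v = ((√(n + 1) : ℝ) : ℂ) • symmetrize H (n + 1)
      (tensorLeft n ψ (v : HilbertTensorPow H n)) := rfl

theorem norm_creationAt_le (n : ℕ) (ψ : H) : ‖creationAt n ψ‖ ≤ √(n + 1) * ‖ψ‖ := by
  refine ContinuousLinearMap.opNorm_le_bound _ (by positivity) fun v => ?_
  have h1 : ‖(creationAt n ψ v : HilbertTensorPow H (n + 1))‖ =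
      √(n + 1) * ‖symmetrize H (n + 1) (tensorLeft n ψ (v : HilbertTensorPow H n))‖ := by
    rw [creationAt_apply, Submodule.coe_smul, norm_smul, Complex.norm_real,
      Real.norm_of_nonneg (Real.sqrt_nonneg _)]
    rfl
  calc ‖creationAt n ψ v‖
      = √(n + 1) * ‖symmetrize H (n + 1) (tensorLeft n ψ (v : HilbertTensorPow H n))‖ := h1
    _ ≤ √(n + 1) * ‖tensorLeft n ψ (v : HilbertTensorPow H n)‖ := by
        gcongr
        exact Submodule.norm_orthogonalProjectionOnto_apply_le _ _
    _ ≤ √(n + 1) * (‖ψ‖ * ‖(v : HilbertTensorPow H n)‖) := by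
        gcongr
        exact norm_tensorLeft_apply_le n ψ _
    _ = _ := by rw [← mul_assoc]; rfl

/-- The inner symmetrisation is redundant: it averages over permutations of the last `n` slots,
which the outer one absorbs. -/
theorem creationAt_symTensor {n : ℕ} (ψ : H) (x : Fin n → H) :
    creationAt n ψ (symTensor x) =
      ((√(n + 1) : ℝ) : ℂ) • symTensor (Fin.cons ψ x : Fin (n + 1) → H) := by
  rw [creationAt_apply]
  congr 1
  have h0 : (n ! : ℂ) ≠ 0 := by exact_mod_cast n.factorial_ne_zero
  have h1 : (symTensor x : HilbertTensorPow H n) = (n ! : ℂ)⁻¹ •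
      ((∑ σ : Equiv.Perm (Fin n), tmk n (x ∘ σ) : TensorPow H n) : HilbertTensorPow H n) := by
    rw [sum_perm_eq_symTensor, smul_smul, inv_mul_cancel₀ h0, one_smul]
  rw [h1, coe_sum_tensor, map_smul, map_smul, map_sum, map_sum]
  have h2 : ∀ σ : Equiv.Perm (Fin n), symmetrize H (n + 1)
      (tensorLeft n ψ (tmk n (x ∘ σ) : HilbertTensorPow H n)) =
      symTensor (Fin.cons ψ x : Fin (n + 1) → H) := fun σ => by
    -- The pair `(0, σ)` encodes the permutation that fixes slot `0` and acts as `σ` on the others.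
    rw [tensorLeft_tmk, ← symTensor_perm _ (Equiv.Perm.decomposeFin.symm (0, σ))]
    congr 3
    ext i
    refine Fin.cases ?_ (fun i => ?_) i
    · simp
    · simp
  simp only [h2, Finset.sum_const, Finset.card_univ, Fintype.card_perm, Fintype.card_fin]
  rw [← Nat.cast_smul_eq_nsmul ℂ, smul_smul, inv_mul_cancel₀ h0, one_smul]

theorem inner_annihilationAt (n : ℕ) (ψ : H) (u : symPow H n) (v : symPow H (n + 1)) :
    ⟪(u : HilbertTensorPow H n), (annihilationAt n ψ v : HilbertTensorPow H n)⟫_ℂ =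
      ⟪(creationAt n ψ u : HilbertTensorPow H (n + 1)), (v : HilbertTensorPow H (n + 1))⟫_ℂ :=
  ContinuousLinearMap.adjoint_inner_right (creationAt n ψ) u v

/-- Laplace expansion of the permanent along the row of `ψ`. A permutation is split into the image
`j` of `0` and a permutation of the rest, so that `y ∘ swap 0 j ∘ succ` lists the vectors other than
`y j`. -/
theorem add_one_mul_inner_symTensor_cons {n : ℕ} (ψ : H) (x : Fin n → H) (y : Fin (n + 1) → H) :
    ((n : ℂ) + 1) * ⟪(symTensor (Fin.cons ψ x : Fin (n + 1) → H) : HilbertTensorPow H (n + 1)),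
      (symTensor y : HilbertTensorPow H (n + 1))⟫_ℂ =
      ∑ j, ⟪ψ, y j⟫_ℂ * ⟪(symTensor x : HilbertTensorPow H n),
        (symTensor (y ∘ Equiv.swap 0 j ∘ Fin.succ) : HilbertTensorPow H n)⟫_ℂ := by
  have h0 : (n ! : ℂ) ≠ 0 := by exact_mod_cast n.factorial_ne_zero
  refine mul_left_cancel₀ h0 ?_
  have h1 := factorial_mul_inner_symTensor (Fin.cons ψ x : Fin (n + 1) → H) y
  rw [Nat.factorial_succ, ← Equiv.sum_comp Equiv.Perm.decomposeFin.symm,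
    Fintype.sum_prod_type] at h1
  push_cast at h1
  rw [← mul_assoc, mul_comm (n ! : ℂ), h1, Finset.mul_sum]
  refine Finset.sum_congr rfl fun j _ => ?_
  rw [mul_left_comm, factorial_mul_inner_symTensor, Finset.mul_sum]
  refine Finset.sum_congr rfl fun σ _ => ?_
  rw [Fin.prod_univ_succ]
  simp only [Fin.cons_zero, Fin.cons_succ, Equiv.Perm.decomposeFin_symm_apply_zero,
    Equiv.Perm.decomposeFin_symm_apply_succ, Function.comp_apply]

theorem sqrt_mul_annihilationAt_symTensor {n : ℕ} (ψ : H) (y : Fin (n + 1) → H) :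
    ((√(n + 1) : ℝ) : ℂ) • annihilationAt n ψ (symTensor y) =
      ∑ j, ⟪ψ, y j⟫_ℂ • symTensor (y ∘ Equiv.swap 0 j ∘ Fin.succ) := by
  refine symPow_ext fun x => ?_
  rw [Submodule.coe_smul, inner_smul_right, inner_annihilationAt, creationAt_symTensor,
    Submodule.coe_smul, inner_smul_left, Complex.conj_ofReal, ← mul_assoc, ← Complex.ofReal_mul,
    Real.mul_self_sqrt (by positivity), Submodule.coe_sum, inner_sum]
  simp only [Submodule.coe_smul, inner_smul_right]
  push_cast
  exact add_one_mul_inner_symTensor_cons ψ x y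

theorem sqrt_ne_zero (n : ℕ) : ((√(n + 1) : ℝ) : ℂ) ≠ 0 := by
  exact_mod_cast (Real.sqrt_pos.mpr (by positivity : (0 : ℝ) < n + 1)).ne'

theorem annihilationAt_creationAt_symTensor {n : ℕ} (ψ : H) (y : Fin n → H) :
    annihilationAt n ψ (creationAt n ψ (symTensor y)) = ⟪ψ, ψ⟫_ℂ • symTensor y +
      ∑ j : Fin n, ⟪ψ, y j⟫_ℂ •
        symTensor ((Fin.cons ψ y : Fin (n + 1) → H) ∘ Equiv.swap 0 j.succ ∘ Fin.succ) := by
  rw [creationAt_symTensor, map_smul, sqrt_mul_annihilationAt_symTensor, Fin.sum_univ_succ]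
  simp only [Fin.cons_zero, Fin.cons_succ]
  congr 3

/-- Removing `y j` and putting `ψ` in front agrees, up to a transposition, with replacing `y j` by
`ψ`. This matches the terms of `a a*` and `a* a` in the commutation relation. -/
theorem cons_comp_swap {n : ℕ} (ψ : H) (y : Fin (n + 1) → H) (j : Fin (n + 1)) :
    (Fin.cons ψ (y ∘ Equiv.swap 0 j ∘ Fin.succ) : Fin (n + 1) → H) =
      ((Fin.cons ψ y : Fin (n + 2) → H) ∘ Equiv.swap 0 j.succ ∘ Fin.succ) ∘ Equiv.swap 0 j := by
  ext i
  refine Fin.cases ?_ (fun k => ?_) i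
  · simp
  · have h : Equiv.swap 0 j k.succ ≠ j := fun h => by
      rw [Equiv.swap_apply_eq_iff, Equiv.swap_apply_right] at h
      exact Fin.succ_ne_zero k h
    simp only [Fin.cons_succ, Function.comp_apply]
    rw [Equiv.swap_apply_of_ne_of_ne (Fin.succ_ne_zero _) (fun h' => h (Fin.succ_injective _ h')),
      Fin.cons_succ]

theorem annihilationAt_creationAt_zero (ψ : H) (v : symPow H 0) :
    annihilationAt 0 ψ (creationAt 0 ψ v) = ⟪ψ, ψ⟫_ℂ • v := by
  refine symPow_induction (p := fun v => annihilationAt 0 ψ (creationAt 0 ψ v) = ⟪ψ, ψ⟫_ℂ • v)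
    (isClosed_eq ((annihilationAt 0 ψ).continuous.comp (creationAt 0 ψ).continuous)
      (continuous_const_smul _)) (fun x => ?_) (fun u v hu hv => ?_)
    (fun c u hu => ?_) v
  · rw [annihilationAt_creationAt_symTensor, Finset.univ_eq_empty, Finset.sum_empty, add_zero]
  · rw [map_add, map_add, hu, hv, smul_add]
  · rw [map_smul, map_smul, hu, smul_comm]

theorem annihilationAt_creationAt_succ (n : ℕ) (ψ : H) (v : symPow H (n + 1)) :
    annihilationAt (n + 1) ψ (creationAt (n + 1) ψ v) =
      ⟪ψ, ψ⟫_ℂ • v + creationAt n ψ (annihilationAt n ψ v) := by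
  refine symPow_induction (p := fun v => annihilationAt (n + 1) ψ (creationAt (n + 1) ψ v) =
      ⟪ψ, ψ⟫_ℂ • v + creationAt n ψ (annihilationAt n ψ v))
    (isClosed_eq ((annihilationAt (n + 1) ψ).continuous.comp (creationAt (n + 1) ψ).continuous)
      ((continuous_const_smul _).add
        ((creationAt n ψ).continuous.comp (annihilationAt n ψ).continuous))) (fun y => ?_) (fun u v hu hv => ?_)
    (fun c u hu => ?_) v
  · rw [annihilationAt_creationAt_symTensor]
    congr 1
    have h1 : annihilationAt n ψ (symTensor y) = ((√(n + 1) : ℝ) : ℂ)⁻¹ •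
        ∑ j, ⟪ψ, y j⟫_ℂ • symTensor (y ∘ Equiv.swap 0 j ∘ Fin.succ) := by
      rw [← sqrt_mul_annihilationAt_symTensor, smul_smul, inv_mul_cancel₀ (sqrt_ne_zero n),
        one_smul]
    rw [h1, map_smul, map_sum, Finset.smul_sum]
    refine Finset.sum_congr rfl fun j _ => ?_
    rw [map_smul, creationAt_symTensor, smul_comm, smul_smul, smul_smul,
      cons_comp_swap, symTensor_perm, mul_assoc, inv_mul_cancel₀ (sqrt_ne_zero n), mul_one]
  · simp only [map_add, hu, hv, smul_add]
    abel
  · rw [map_smul, map_smul, hu, map_smul, map_smul, smul_add, smul_comm]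

theorem annihilation_mul_creation (ψ : H) :
    annihilation ψ * creation ψ = ⟪ψ, ψ⟫_ℂ • 1 + creation ψ * annihilation ψ := by
  refine LinearMap.ext fun Φ => Subtype.ext (lp.ext (funext fun n => ?_))
  cases n with
  | zero =>
    refine (annihilationAt_creationAt_zero ψ ((Φ : Fock H) 0)).trans ?_
    -- In the vacuum sector `a* a` vanishes, so only the scalar term remains.
    exact (add_zero _).symm
  | succ n => exact annihilationAt_creationAt_succ n ψ ((Φ : Fock H) (n + 1))

end SymmetricTensors

/-! ## Essential self-adjointness on smaller domains -/

section Cores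

variable {K : Type u} [NormedAddCommGroup K] [InnerProductSpace ℂ K] [CompleteSpace K]
variable {D : Submodule ℂ K} {A : Module.End ℂ D}

/-- Closed graph theorem: a closable operator composed with a bounded map from a Banach space into
its domain is everywhere defined with closed graph. No explicit estimate on the sectors is needed.
-/
theorem continuous_operatorOn_comp (hA : (operatorOn D A).IsClosable) {V : Type*}
    [NormedAddCommGroup V] [NormedSpace ℂ V] [CompleteSpace V] (ι : V →L[ℂ] K)
    (hι : ∀ v, ι v ∈ D) : Continuous fun v => (A ⟨ι v, hι v⟩ : K) := by
  let g : V →ₗ[ℂ] K := D.subtype ∘ₗ A ∘ₗ (ι : V →ₗ[ℂ] K).codRestrict D hι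
  refine LinearMap.continuous_of_seq_closed_graph (g := g) fun u x y hx hy => ?_
  have h1 : (ι x, y) ∈ (operatorOn D A).closure.graph := by
    rw [← hA.graph_closure_eq_closure_graph]
    exact mem_closure_of_tendsto (((ι.continuous.tendsto x).comp hx).prodMk_nhds hy)
      (Eventually.of_forall fun n => mk_mem_graph_operatorOn A ⟨ι (u n), hι _⟩)
  have h2 : (ι x, g x) ∈ (operatorOn D A).closure.graph :=
    LinearPMap.le_graph_of_le (LinearPMap.le_closure _) (mk_mem_graph_operatorOn A ⟨ι x, hι x⟩)
  exact LinearPMap.mem_graph_snd_inj _ h1 h2 rfl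

theorem mk_mem_graph_domRestrict {F : Submodule ℂ K} (Φ : D) (hΦ : (Φ : K) ∈ F) :
    ((Φ : K), (A Φ : K)) ∈ ((operatorOn D A).domRestrict F).graph :=
  (LinearPMap.mem_graph_iff _).mpr ⟨⟨Φ, hΦ, Φ.2⟩, rfl, rfl⟩

/-- The core criterion: the hypothesis makes the two closures equal. Density of the smaller domain
also follows from it, by projecting the graph closure to the first coordinate. -/
theorem isEssentiallySelfAdjoint_domRestrict (hA : IsEssentiallySelfAdjoint (operatorOn D A))
    {F : Submodule ℂ K}
    (hF : ∀ Φ : D, ((Φ : K), (A Φ : K)) ∈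
      ((operatorOn D A).domRestrict F).graph.topologicalClosure) :
    IsEssentiallySelfAdjoint ((operatorOn D A).domRestrict F) := by
  have hle : (operatorOn D A).domRestrict F ≤ operatorOn D A := LinearPMap.domRestrict_le
  have hc := hA.2.1.leIsClosable hle
  have heq : ((operatorOn D A).domRestrict F).closure = (operatorOn D A).closure := by
    refine LinearPMap.eq_of_eq_graph ?_
    rw [← hc.graph_closure_eq_closure_graph, ← hA.2.1.graph_closure_eq_closure_graph]
    refine le_antisymm (Submodule.topologicalClosure_mono (LinearPMap.le_graph_of_le hle)) ?_
    refine Submodule.topologicalClosure_minimal _ (fun q hq => ?_)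
      (Submodule.isClosed_topologicalClosure _)
    obtain ⟨Φ, rfl⟩ := mem_graph_operatorOn.mp hq
    exact hF Φ
  refine ⟨?_, hc, heq ▸ hA.2.2⟩
  have hD : Dense (D : Set K) := hA.1
  refine dense_iff_closure_eq.mpr (Set.eq_univ_of_univ_subset ?_)
  rw [← hD.closure_eq]
  refine closure_minimal (fun Φ hΦ => ?_) isClosed_closure
  refine map_mem_closure continuous_fst (hF ⟨Φ, hΦ⟩) fun q hq => ?_
  obtain ⟨Ψ, h1, -⟩ := (LinearPMap.mem_graph_iff _).mp hq
  rw [← h1]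
  exact Ψ.2

end Cores

/-! ### Totality of symmetrised tensors with entries in a total set -/

section MultilinearDensity

variable {H : Type u} [NormedAddCommGroup H] [InnerProductSpace ℂ H]

theorem norm_tmk {n : ℕ} (x : Fin n → H) : ‖tmk n x‖ = ∏ i, ‖x i‖ := by
  have h : ‖tmk n x‖ ^ 2 = (∏ i, ‖x i‖) ^ 2 := by
    have h1 := inner_self_eq_norm_sq_to_K (𝕜 := ℂ) (tmk n x)
    rw [inner_eq_tinner, tinner_tmk] at h1
    simp only [inner_self_eq_norm_sq_to_K] at h1
    rw [← Finset.prod_pow]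
    exact_mod_cast h1.symm
  exact (pow_left_inj₀ (norm_nonneg _) (by positivity) two_ne_zero).mp h

theorem continuous_tmk_update {n : ℕ} (x : Fin n → H) (a : Fin n) :
    Continuous fun z => tmk n (Function.update x a z) := by
  refine AddMonoidHomClass.continuous_of_bound ((tmk n).toLinearMap x a)
    (∏ i ∈ Finset.univ.erase a, ‖x i‖) fun z => ?_
  rw [MultilinearMap.toLinearMap_apply, norm_tmk, ← Finset.mul_prod_erase _ _ (Finset.mem_univ a),
    Function.update_self, mul_comm]
  refine le_of_eq (congrArg (· * ‖z‖) (Finset.prod_congr rfl fun i hi => ?_))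
  rw [Function.update_of_ne (Finset.ne_of_mem_erase hi)]

theorem symTensor_mem_of_dense_span {s : Set H}
    (hs : (Submodule.span ℂ s).topologicalClosure = ⊤) {n : ℕ} (M : Submodule ℂ (symPow H n))
    (hM : IsClosed (M : Set (symPow H n))) (h : ∀ x : Fin n → H, (∀ i, x i ∈ s) → symTensor x ∈ M)
    (x : Fin n → H) : symTensor x ∈ M := by
  -- The slots in `t` are unrestricted. Freeing one more slot uses only linearity and continuity in
  -- that slot, so joint continuity of the tensor product is not needed.
  have key : ∀ (t : Finset (Fin n)) (x : Fin n → H), (∀ i, i ∉ t → x i ∈ s) → symTensor x ∈ M := by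
    intro t
    induction t using Finset.induction_on with
    | empty => exact fun x hx => h x fun i => hx i (Finset.notMem_empty i)
    | insert a t _ ih =>
      intro x hx
      let L : H →ₗ[ℂ] symPow H n := (symmetrize H n : HilbertTensorPow H n →ₗ[ℂ] symPow H n) ∘ₗ
        (UniformSpace.Completion.toComplL (𝕜 := ℂ) (E := TensorPow H n) :
          TensorPow H n →ₗ[ℂ] HilbertTensorPow H n) ∘ₗ (tmk n).toLinearMap x a
      have hL : ∀ z, L z = symTensor (Function.update x a z) := fun z => rfl
      have hLc : Continuous L := (symmetrize H n).continuous.comp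
        ((UniformSpace.Completion.continuous_coe _).comp (continuous_tmk_update x a))
      have h1 : Submodule.span ℂ s ≤ M.comap L := by
        rw [Submodule.span_le]
        intro z hz
        change L z ∈ M
        rw [hL]
        refine ih _ fun i hi => ?_
        by_cases hia : i = a
        · subst hia
          rwa [Function.update_self]
        · rw [Function.update_of_ne hia]
          exact hx i fun hm => (Finset.mem_insert.mp hm).elim hia hi
      have h2 := Submodule.topologicalClosure_minimal _ h1 (hM.preimage hLc)
      rw [hs] at h2
      have h3 : L (x a) ∈ M := h2 Submodule.mem_top
      rwa [hL, Function.update_eq_self] at h3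
  exact key Finset.univ x fun i hi => absurd (Finset.mem_univ i) hi

theorem mem_of_symTensor_mem {s : Set H} (hs : (Submodule.span ℂ s).topologicalClosure = ⊤) {n : ℕ}
    (M : Submodule ℂ (symPow H n)) (hM : IsClosed (M : Set (symPow H n)))
    (h : ∀ x : Fin n → H, (∀ i, x i ∈ s) → symTensor x ∈ M) (v : symPow H n) : v ∈ M :=
  symPow_induction (p := fun v => v ∈ M) hM (symTensor_mem_of_dense_span hs M hM h)
    (fun _ _ => M.add_mem) (fun c _ => M.smul_mem c) v

end MultilinearDensity

section Fock

variable {H : Type u} [NormedAddCommGroup H] [InnerProductSpace ℂ H]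

/-! ## Application to Fock space -/

theorem exists_mem_levelLE (Φ : finiteParticle H) :
    ∃ m, (Φ : Fock H) ∈ levelLE (fun n : ℕ => symPow H n) m := by
  obtain ⟨m, hm⟩ := Φ.2.bddAbove
  exact ⟨m, fun n hn => by_contra fun h => hn.not_ge (hm h)⟩

theorem incl_mem_finiteParticle (n : ℕ) (a : symPow H n) :
    incl (fun n : ℕ => symPow H n) n a ∈ finiteParticle H :=
  (Set.finite_singleton n).subset fun m hm => by
    by_contra h
    exact hm (incl_apply_ne (G := fun n : ℕ => symPow H n) a h)

theorem dense_finiteParticle : Dense (finiteParticle H : Set (Fock H)) :=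
  dense_of_incl_mem (G := fun n : ℕ => symPow H n) incl_mem_finiteParticle

theorem truncRaise_eventually_eq (ψ : H) (Φ : finiteParticle H) :
    ∀ᶠ N in atTop, truncRaise (G := fun n : ℕ => symPow H n) (fun n => creationAt n ψ) N Φ =
      creation ψ Φ := by
  obtain ⟨m, hm⟩ := exists_mem_levelLE Φ
  filter_upwards [eventually_gt_atTop m] with N hN
  exact truncRaise_eq (G := fun n : ℕ => symPow H n) _ hN hm rfl fun n => rfl

theorem truncLower_eventually_eq (ψ : H) (Φ : finiteParticle H) :
    ∀ᶠ N in atTop, truncLower (G := fun n : ℕ => symPow H n) (fun n => creationAt n ψ) N Φ =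
      annihilation ψ Φ := by
  obtain ⟨m, hm⟩ := exists_mem_levelLE Φ
  filter_upwards [eventually_gt_atTop m] with N hN
  exact truncLower_eq (G := fun n : ℕ => symPow H n) _ hN hm fun n => rfl

theorem weyl_analyticApprox (χ : H) :
    AnalyticApprox (finiteParticle H) (annihilation χ - creation χ)
      (fun N => truncLower (G := fun n : ℕ => symPow H n) (fun n => creationAt n χ) N -
        truncRaise (G := fun n : ℕ => symPow H n) (fun n => creationAt n χ) N)
      (1 / (2 * ‖χ‖ + 1)) :=
  analyticApprox_lower_sub_raise (G := fun n : ℕ => symPow H n) (norm_nonneg χ)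
    (fun n => norm_creationAt_le n χ) dense_finiteParticle exists_mem_levelLE
    (truncRaise_eventually_eq χ) (truncLower_eventually_eq χ)

theorem I_smul_squeezing (ψ : H) :
    Complex.I • squeezing ψ = (1 / 2 : ℂ) • (creation ψ ^ 2 - annihilation ψ ^ 2) := by
  rw [squeezing, smul_smul, ← neg_sub (creation ψ ^ 2), smul_neg, ← neg_smul]
  congr 1
  rw [← mul_div_assoc, Complex.I_mul_I]
  norm_num

theorem squeezing_analyticApprox {ψ : H} (hψ : ‖ψ‖ = 1) :
    AnalyticApprox (finiteParticle H) (Complex.I • squeezing ψ)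
      (fun N => (1 / 2 : ℂ) •
        (truncRaise (G := fun n : ℕ => symPow H n) (fun n => creationAt n ψ) N ^ 2 -
          truncLower (G := fun n : ℕ => symPow H n) (fun n => creationAt n ψ) N ^ 2)) (1 / 2) := by
  rw [I_smul_squeezing]
  exact analyticApprox_raise_sq_sub_lower_sq (G := fun n : ℕ => symPow H n)
    (fun n => hψ ▸ norm_creationAt_le n ψ) dense_finiteParticle exists_mem_levelLE
    (truncRaise_eventually_eq ψ) (truncLower_eventually_eq ψ)

theorem summable_squeezing {ψ : H} (hψ : ‖ψ‖ = 1) (Φ : finiteParticle H) {r : ℝ}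
    (hr : |r| < 1 / 2) : Summable fun n : ℕ =>
      |r| ^ n / (n ! : ℝ) * ‖((squeezing ψ ^ n) Φ : Fock H)‖ := by
  refine ((squeezing_analyticApprox hψ).bound_pow Φ (abs_nonneg r) hr).congr fun n => ?_
  rw [smul_pow, LinearMap.smul_apply, Submodule.coe_smul, norm_smul, norm_pow, Complex.norm_I,
    one_pow, one_mul]

theorem squeezing_isEssentiallySelfAdjoint {ψ : H} (hψ : ‖ψ‖ = 1) :
    IsEssentiallySelfAdjoint (toUnbounded (squeezing ψ)) :=
  (squeezing_analyticApprox hψ).isEssentiallySelfAdjoint rfl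

theorem occupationSpan_le_finiteParticle (s : Set H) : occupationSpan s ≤ finiteParticle H := by
  rw [occupationSpan, Submodule.span_le]
  rintro _ ⟨n, x, -, rfl⟩
  exact incl_mem_finiteParticle n _

theorem finiteParticle_eq_sum (Φ : finiteParticle H) : ∃ m, Φ = ∑ n ∈ Finset.range m,
    (⟨incl (fun n : ℕ => symPow H n) n ((Φ : Fock H) n), incl_mem_finiteParticle n _⟩ :
      finiteParticle H) := by
  obtain ⟨m, hm⟩ := exists_mem_levelLE Φ
  refine ⟨m + 1, Subtype.ext (lp.ext (funext fun k => ?_))⟩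
  rw [Submodule.coe_sum]
  refine Eq.trans ?_ (sum_lp_apply (G := fun n : ℕ => symPow H n) _ _ k).symm
  by_cases hk : k < m + 1
  · rw [Finset.sum_eq_single_of_mem k (Finset.mem_range.mpr hk) fun n _ hn =>
      incl_apply_ne (G := fun n : ℕ => symPow H n) _ hn.symm]
    exact (incl_apply_self (G := fun n : ℕ => symPow H n) k _).symm
  · rw [Finset.sum_eq_zero fun n hn => incl_apply_ne (G := fun n : ℕ => symPow H n) _ ?_]
    · exact hm k (by omega)
    · have := Finset.mem_range.mp hn
      omega

/-- On one `n`-particle sector `v ↦ (v, A v)` is continuous, so the vectors sent into the closure of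
the restricted graph form a closed subspace. It contains the symmetrised tensors over `s`, hence the
whole sector, and finite-particle vectors are finite sums over sectors. -/
theorem squeezing_isEssentiallySelfAdjoint_occupationSpan {ψ : H} (hψ : ‖ψ‖ = 1) {s : Set H}
    (hs : (Submodule.span ℂ s).topologicalClosure = ⊤) :
    IsEssentiallySelfAdjoint ((toUnbounded (squeezing ψ)).domRestrict (occupationSpan s)) := by
  have hA := squeezing_isEssentiallySelfAdjoint hψ
  refine isEssentiallySelfAdjoint_domRestrict hA fun Φ => ?_
  set M := ((operatorOn (finiteParticle H) (squeezing ψ)).domRestrict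
    (occupationSpan s)).graph.topologicalClosure with hMdef
  let L : finiteParticle H →ₗ[ℂ] Fock H × Fock H :=
    (finiteParticle H).subtype.prod ((finiteParticle H).subtype ∘ₗ squeezing ψ)
  have hincl : ∀ n v, L ⟨incl (fun n : ℕ => symPow H n) n v, incl_mem_finiteParticle n v⟩ ∈ M := by
    intro n
    let J : symPow H n →ₗ[ℂ] finiteParticle H :=
      (incl (fun n : ℕ => symPow H n) n : symPow H n →ₗ[ℂ] Fock H).codRestrict (finiteParticle H)
        (incl_mem_finiteParticle n)
    have hcont : Continuous fun v => L (J v) :=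
      (incl (fun n : ℕ => symPow H n) n).continuous.prodMk
        (continuous_operatorOn_comp hA.2.1 (incl (fun n : ℕ => symPow H n) n)
          (incl_mem_finiteParticle n))
    refine mem_of_symTensor_mem hs (M.comap (L ∘ₗ J))
      ((Submodule.isClosed_topologicalClosure _).preimage hcont) fun x hx => ?_
    refine Submodule.le_topologicalClosure _
      (mk_mem_graph_domRestrict (J (symTensor x)) (Submodule.subset_span ⟨n, x, hx, rfl⟩))
  obtain ⟨m, hm⟩ := finiteParticle_eq_sum Φ
  change L Φ ∈ M
  rw [hm, map_sum]
  exact Submodule.sum_mem _ fun n _ => hincl n _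

/-! ### Scaling of the one-particle vector, the commutator, and conjugation of the Weyl operator -/

theorem tensorLeft_smul (n : ℕ) (c : ℂ) (ψ : H) (v : HilbertTensorPow H n) :
    tensorLeft n (c • ψ) v = c • tensorLeft n ψ v := by
  refine UniformSpace.Completion.induction_on v (isClosed_eq (tensorLeft n (c • ψ)).continuous
    ((continuous_const_smul c).comp (tensorLeft n ψ).continuous)) fun t => ?_
  rw [tensorLeft, tensorLeft, ContinuousLinearMap.completion_apply_coe,
    ContinuousLinearMap.completion_apply_coe, ← UniformSpace.Completion.coe_smul]
  congr 1
  change tcons n (c • ψ) t = c • tcons n ψ t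
  rw [tcons, tcons, map_smul, tlift, tlift, map_smul]
  rfl

theorem creationAt_smul (n : ℕ) (c : ℂ) (ψ : H) (v : symPow H n) :
    creationAt n (c • ψ) v = c • creationAt n ψ v := by
  rw [creationAt_apply, creationAt_apply, tensorLeft_smul, map_smul, smul_comm]

theorem annihilationAt_smul (n : ℕ) (c : ℂ) (ψ : H) (v : symPow H (n + 1)) :
    annihilationAt n (c • ψ) v = conj c • annihilationAt n ψ v := by
  refine symPow_ext fun x => ?_
  rw [Submodule.coe_smul, inner_smul_right, inner_annihilationAt, inner_annihilationAt,
    creationAt_smul, Submodule.coe_smul, inner_smul_left]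

/-- Creation is linear and annihilation antilinear in the vector, so a common factor comes out
because the scalar is real. -/
theorem weylGenerator_ofReal_smul (r : ℝ) (ψ : H) : weylGenerator ((r : ℂ) • ψ) =
    operatorOn (finiteParticle H) ((r : ℂ) • (annihilation ψ - creation ψ)) := by
  have h1 : annihilation ((r : ℂ) • ψ) = (r : ℂ) • annihilation ψ := by
    refine LinearMap.ext fun Φ => Subtype.ext (lp.ext (funext fun n => ?_))
    refine (annihilationAt_smul n r ψ ((Φ : Fock H) (n + 1))).trans ?_
    rw [Complex.conj_ofReal]
    rfl
  have h2 : creation ((r : ℂ) • ψ) = (r : ℂ) • creation ψ := by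
    refine LinearMap.ext fun Φ => Subtype.ext (lp.ext (funext fun n => ?_))
    cases n with
    | zero => exact (smul_zero (r : ℂ)).symm
    | succ n => exact creationAt_smul n r ψ ((Φ : Fock H) n)
  rw [weylGenerator, h1, h2]
  exact congrArg (operatorOn (finiteParticle H))
    (smul_sub (r : ℂ) (annihilation ψ) (creation ψ)).symm

theorem commutator_of_ccr {M : Type*} [AddCommGroup M] [Module ℂ M] {a c : Module.End ℂ M}
    (h : a * c = 1 + c * a) :
    ((1 / 2 : ℂ) • (c ^ 2 - a ^ 2)) * (a - c) - (a - c) * ((1 / 2 : ℂ) • (c ^ 2 - a ^ 2)) =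
      a - c := by
  have h2 : (c ^ 2 - a ^ 2) * (a - c) - (a - c) * (c ^ 2 - a ^ 2) = (2 : ℂ) • (a - c) := by
    -- The relations `[a, c²] = 2c` and `[a², c] = 2a` produce the factor `2` that cancels the `1/2`
    -- of the squeezing operator.
    have h3 : a * c ^ 2 = (2 : ℂ) • c + c ^ 2 * a := by
      rw [pow_two, ← mul_assoc, h, add_mul, one_mul, mul_assoc, h, mul_add, mul_one, two_smul,
        ← mul_assoc, add_assoc]
    have h4 : a ^ 2 * c = (2 : ℂ) • a + c * a ^ 2 := by
      rw [pow_two, mul_assoc, h, mul_add, mul_one, ← mul_assoc, h, add_mul, one_mul, two_smul,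
        mul_assoc, add_assoc]
    rw [mul_sub, sub_mul, sub_mul, mul_sub, sub_mul, sub_mul, h3, h4, smul_sub,
      ← pow_succ, ← pow_succ, ← pow_succ', ← pow_succ']
    abel
  rw [smul_mul_assoc, mul_smul_comm, ← smul_sub, h2, smul_smul]
  norm_num

theorem commutator_squeezing {ψ : H} (hψ : ‖ψ‖ = 1) :
    (Complex.I • squeezing ψ) * (annihilation ψ - creation ψ) -
      (annihilation ψ - creation ψ) * (Complex.I • squeezing ψ) =
      annihilation ψ - creation ψ := by
  rw [I_smul_squeezing]
  refine commutator_of_ccr ?_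
  rw [annihilation_mul_creation, inner_self_eq_norm_sq_to_K, hψ]
  simp

theorem weylGenerator_isUnitaryGroupOf (χ : H) :
    IsUnitaryGroupOf (weylGenerator χ).closure (weyl_analyticApprox χ).group :=
  (weyl_analyticApprox χ).isUnitaryGroupOf

theorem dense_domain_weylGenerator_closure (χ : H) :
    Dense ((weylGenerator χ).closure.domain : Set (Fock H)) :=
  dense_finiteParticle.mono (LinearPMap.le_closure (weylGenerator χ)).1

theorem weyl_eq {χ : H} {U : ℝ → unitary (Fock H →L[ℂ] Fock H)}
    (hU : IsUnitaryGroupOf (weylGenerator χ).closure U) : weyl χ = U 1 :=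
  hU.unitaryExp_eq (dense_domain_weylGenerator_closure χ)

theorem squeezing_isUnitaryGroupOf {ψ : H} (hψ : ‖ψ‖ = 1) :
    IsUnitaryGroupOf (Complex.I • (toUnbounded (squeezing ψ)).closure)
      (squeezing_analyticApprox hψ).group := by
  rw [← closure_smul (squeezing_isEssentiallySelfAdjoint hψ).2.1 Complex.I_ne_zero]
  exact (squeezing_analyticApprox hψ).isUnitaryGroupOf

/-- The conjugated Weyl group of `ψ` is generated by the closed Weyl generator of `e^l ψ`; both
sides are its value at time `1`. -/
theorem squeezing_conj_weyl {ψ : H} (hψ : ‖ψ‖ = 1) (l : ℝ) :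
    (squeezing_analyticApprox hψ).group l * weyl ψ * star ((squeezing_analyticApprox hψ).group l) =
      weyl (((Real.exp l : ℝ) : ℂ) • ψ) := by
  have h1 : IsUnitaryGroupOf (weylGenerator (((Real.exp l : ℝ) : ℂ) • ψ)).closure
      fun t => (squeezing_analyticApprox hψ).group l * (weyl_analyticApprox ψ).group t *
        star ((squeezing_analyticApprox hψ).group l) := by
    rw [weylGenerator_ofReal_smul]
    exact (squeezing_analyticApprox hψ).isUnitaryGroupOf_conj (commutator_squeezing hψ)
      (weyl_analyticApprox ψ).isClosable (weylGenerator_isUnitaryGroupOf ψ) l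
  exact (congrArg (fun W => (squeezing_analyticApprox hψ).group l * W *
    star ((squeezing_analyticApprox hψ).group l))
      (weyl_eq (weylGenerator_isUnitaryGroupOf ψ))).trans (weyl_eq h1).symm

end Fock

end BosonFock

end

theorem mainTheorem10 {H : Type*} [NormedAddCommGroup H] [InnerProductSpace ℂ H]
    [CompleteSpace H] :
    -- the Weyl generators are well defined: `W[χ]` is the exponential of the closure
    (∀ χ : H, (BosonFock.weylGenerator χ).IsClosable ∧
      (∃ U, BosonFock.IsUnitaryGroupOf (BosonFock.weylGenerator χ).closure U) ∧
      ∀ U, BosonFock.IsUnitaryGroupOf (BosonFock.weylGenerator χ).closure U →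
        BosonFock.weyl χ = U 1) ∧
    ∀ ψ : H, ‖ψ‖ = 1 →
      -- all finite-particle vectors are analytic for the squeezing operator
      (∀ (Φ : BosonFock.finiteParticle H) (r : ℝ), |r| < 1 / 2 →
        Summable fun n : ℕ => |r| ^ n / (n.factorial : ℝ) *
          ‖((BosonFock.squeezing ψ ^ n) Φ : BosonFock.Fock H)‖) ∧
      -- it is essentially self-adjoint
      BosonFock.IsEssentiallySelfAdjoint
        (BosonFock.toUnbounded (BosonFock.squeezing ψ)) ∧
      -- also on the span of the Fock basis vectors of any Hilbert basis `s ∋ ψ` of `H`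
      (∀ s : Set H, Orthonormal ℂ ((↑) : s → H) →
        (Submodule.span ℂ s).topologicalClosure = ⊤ → ψ ∈ s →
        BosonFock.occupationSpan s ≤ BosonFock.finiteParticle H ∧
        BosonFock.IsEssentiallySelfAdjoint
          ((BosonFock.toUnbounded (BosonFock.squeezing ψ)).domRestrict
            (BosonFock.occupationSpan s))) ∧
      -- and its closure `A` generates a unitary group `E l = exp (i l A)` rescaling `W[ψ]`
      ∃ E : ℝ → unitary (BosonFock.Fock H →L[ℂ] BosonFock.Fock H),
        BosonFock.IsUnitaryGroupOf
          (Complex.I • (BosonFock.toUnbounded (BosonFock.squeezing ψ)).closure) E ∧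
        ∀ l : ℝ, E l * BosonFock.weyl ψ * star (E l) =
          BosonFock.weyl (((Real.exp l : ℝ) : ℂ) • ψ) := by

  refine ⟨fun χ => ⟨(BosonFock.weyl_analyticApprox χ).isClosable,
    ⟨_, BosonFock.weylGenerator_isUnitaryGroupOf χ⟩, fun U hU => BosonFock.weyl_eq hU⟩,
    fun ψ hψ => ⟨fun Φ r hr => BosonFock.summable_squeezing hψ Φ hr,
      BosonFock.squeezing_isEssentiallySelfAdjoint hψ,
      fun s _ hs _ => ⟨BosonFock.occupationSpan_le_finiteParticle s,
        BosonFock.squeezing_isEssentiallySelfAdjoint_occupationSpan hψ hs⟩,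
      _, BosonFock.squeezing_isUnitaryGroupOf hψ, BosonFock.squeezing_conj_weyl hψ⟩⟩
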